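/- Let $(X,\mathcal B,\mu)$ be a standard probability space, $\alpha$ an at most countable partition of $X$ into measurable sets of positive measure and $\theta:X\to X$ a Markov map with respect to $\alpha$: $\theta$ is invertible, bimeasurable and non-singular from each $a\in\alpha$ onto $\theta(a)$; for $a,b\in\alpha$ either $\mu(a\cap\theta(b))=0$ or $\mu(a\setminus\theta(b))=0$; and the cylinders $[w]=\bigcap_{k=1}^{n}\theta^{-(k-1)}(w_k)$, $w=(w_1,\dots,w_n)\in\alpha^n$, $n\ge1$, generate $\mathcal B$ up to null sets. Assume that $(X,\theta,\mu,\alpha)$ is a Gibbs–Markov map with full branches: $\theta(a)=X$ mod $\mu$ for all $a\in\alpha$, and there are $C>0$, $r\in(0,1)$ such that, with $\tau_w$ the inverse of $\theta^n|_{[w]}$ and $\varphi_w=d(\mu\circ\tau_w)/d\mu$, $$|\log\varphi_w(x)-\log\varphi_w(y)|\le C\,r^{\min\{i\,:\,x_i\ne y_i\}}$$ for all non-empty words $w$ and a.e. $x,y$, where $x_i\in\alpha$ is the cell containing $\theta^i(x)$ (the right-hand side is $0$ if $x_i=y_i$ for all $i$). Let $\mathcal G=(\mathbf V,\mathbf E)$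 be a directed graph with countable vertex set and let $\kappa_x:\mathbf V\to\mathbf V$ $(x\in X)$ be bijections with $(g,\kappa_x(g))\in\mathbf E$ for all $x,g$ and $\kappa_x=\kappa_y$ whenever $x,y$ lie in the same element of $\alpha$. Let $Y=X\times\mathbf V$, equipped with the product of $\mu$ and the counting measure $m_{\mathbf V}$, let $T(x,g)=(\theta x,\kappa_x(g))$ and $\kappa^n_x=\kappa_{\theta^{n-1}x}\circ\cdots\circ\kappa_x$. Assume that $T$ is topologically transitive: for all $a,b\in\alpha$ and $v,w\in\mathbf V$ there is $n\ge1$ such that $T^n(a\times\{v\})\cap(b\times\{w\})$ has positive $\mu\otimes m_{\mathbf V}$-measure. Let $$\mathcal H_\infty=\Big\{f:Y\to\mathbb C\ \Big|\ \sum_{v\in\mathbf V}\|f(\cdot,v)\|_{L^\infty(\mu)}^2<\infty\Big\}$$ with norm $\big(\sum_v\|f(\cdot,v)\|_\infty^2\big)^{1/2}$ (functions being identified if they agree a.e.). Then there is a unique bounded operator $\widehat T$ on $\mathcal H_\infty$ that acts on $\mathcal H_\infty\cap L^1(Y)$ as the transfer operator of $T$, that is, $\widehat T g\in L^1(Y)$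 and $\int (f\circ T)\,g\,d(\mu\otimes m_{\mathbf V})=\int f\,\widehat T g\,d(\mu\otimes m_{\mathbf V})$ for all $g\in\mathcal H_\infty\cap L^1(Y)$ and all bounded measurable $f$. The number $$R(T)=\limsup_{n\to\infty}\ \mu(\{x\in X:\kappa^n_x(\mathbf o)=\mathbf o\})^{1/n}$$ does not depend on $\mathbf o\in\mathbf V$, and the spectral radius $\rho(\widehat T)$ of $\widehat T:\mathcal H_\infty\to\mathcal H_\infty$ satisfies $$R(T)\le\rho(\widehat T)\le1 .$$ If, moreover, the extension is symmetric in the sense that there are $C_n>0$ and $N_n\in\mathbb N\cup\{0\}$ with $C_n^{1/n}\to1$, $N_n/n\to0$ and $$\mu(\{x:\kappa^n_x(v)=w\})\le C_n\sum_{k=\max(n-N_n,\,0)}^{n+N_n}\mu(\{x:\kappa^k_x(w)=v\})\qquad\text{for all } n\ge1,\ v,w\in\mathbf V,$$ then $\rho(\widehat T)=R(T)$. -/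

import Mathlib

open MeasureTheory Filter Topology
open scoped ENNReal

noncomputable section

namespace GraphExtension

variable {X ι V : Type*}

/-- The cylinder `[w₁ … wₙ] = {x | θ^(k-1) x ∈ α w_k for k = 1, …, n}` of a finite word. -/
def cylinder (θ : X → X) (α : ι → Set X) : List ι → Set X
  | [] => Set.univ
  | i :: w => α i ∩ θ ⁻¹' cylinder θ α w

/-- `(X, θ, μ, α)` is a Markov map: `α` is a (countable) partition of `X` into measurable sets of
positive measure, `θ` is invertible, bimeasurable and non-singular from each cell onto its image,
images of cells are unions of cells mod `μ`, and the cylinders generate the σ-algebra mod `μ`. -/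
structure IsMarkovMap [MeasurableSpace X] (θ : X → X) (μ : Measure X) (α : ι → Set X) : Prop where
  measurable_cell : ∀ i, MeasurableSet (α i)
  cell_pos : ∀ i, 0 < μ (α i)
  disjoint : Pairwise (fun i j => Disjoint (α i) (α j))
  cover : ⋃ i, α i = Set.univ
  measurable_map : Measurable θ
  injOn : ∀ i, Set.InjOn θ (α i)
  measurable_image : ∀ i, ∀ B ⊆ α i, MeasurableSet B → MeasurableSet (θ '' B)
  nonsingular : ∀ i, ∀ B ⊆ α i, MeasurableSet B → (μ (θ '' B) = 0 ↔ μ B = 0)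
  markov : ∀ i j, μ (α i ∩ θ '' α j) = 0 ∨ μ (α i ∩ (θ '' α j)ᶜ) = 0
  generating : ∀ B, MeasurableSet B →
    ∃ B', MeasurableSet[MeasurableSpace.generateFrom
      {s | ∃ w : List ι, w ≠ [] ∧ s = cylinder θ α w}] B' ∧ B =ᵐ[μ] B'

/-- The Jacobian `φ_w = d(μ ∘ τ_w)/dμ` of the inverse branch `τ_w : θⁿ[w] → [w]`, `n = |w|`.
As `θⁿ` is injective on `[w]`, the measure `B ↦ μ (τ_w (B ∩ θⁿ[w])) = μ ([w] ∩ θ⁻ⁿ B)` is the image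
of `μ` restricted to `[w]` under `θⁿ`. -/
def branchJacobian [MeasurableSpace X] (θ : X → X) (μ : Measure X) (α : ι → Set X)
    (w : List ι) : X → ℝ≥0∞ :=
  ((μ.restrict (cylinder θ α w)).map (θ^[w.length])).rnDeriv μ

open Classical in
/-- The symbolic distance `d_r(x, y) = r ^ min {i | x_i ≠ y_i}`, where `x_i` is the cell of
`θ^i x`; it is `0` if `x` and `y` have the same itinerary. -/
def symbolicDist (θ : X → X) (α : ι → Set X) (r : ℝ) (x y : X) : ℝ :=
  if h : ∃ i : ℕ, ¬ ∃ j, θ^[i] x ∈ α j ∧ θ^[i] y ∈ α j then r ^ Nat.find h else 0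

/-- `(X, θ, μ, α)` is a Gibbs–Markov map with full branches. -/
structure IsFullGibbsMarkovMap [MeasurableSpace X] (θ : X → X) (μ : Measure X)
    (α : ι → Set X) : Prop extends IsMarkovMap θ μ α where
  full : ∀ i, μ (θ '' α i)ᶜ = 0
  distortion : ∃ C > (0 : ℝ), ∃ r ∈ Set.Ioo (0 : ℝ) 1, ∀ w : List ι, w ≠ [] →
    ∀ᵐ x ∂μ, ∀ᵐ y ∂μ,
      |Real.log (branchJacobian θ μ α w x).toReal - Real.log (branchJacobian θ μ α w y).toReal|
        ≤ C * symbolicDist θ α r x y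

/-- `κ` is a nearest neighbour cocycle for the graph `G` (each `κ x` being a bijection of the
vertex set): it moves along edges and is constant on the cells of the partition. -/
structure IsNearestNeighbourCocycle (α : ι → Set X) (G : Digraph V) (κ : X → Equiv.Perm V) :
    Prop where
  adj : ∀ x g, G.Adj g (κ x g)
  const : ∀ i, ∀ x ∈ α i, ∀ y ∈ α i, κ x = κ y

/-- The graph extension `T (x, g) = (θ x, κ_x g)` on `Y = X × V`. -/
def extension (θ : X → X) (κ : X → Equiv.Perm V) (p : X × V) : X × V :=
  (θ p.1, κ p.1 p.2)

/-- `κⁿ_x = κ_{θ^(n-1) x} ∘ ⋯ ∘ κ_x`. -/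
def iterCocycle (θ : X → X) (κ : X → Equiv.Perm V) : ℕ → X → Equiv.Perm V
  | 0, _ => 1
  | n + 1, x => κ (θ^[n] x) * iterCocycle θ κ n x

/-- Topological transitivity of the extension, with respect to the partition of `Y = X × V` into
the sets `α i × {v}` and the product of `μ` with the counting measure. -/
def IsTransitiveExtension [MeasurableSpace X] [MeasurableSpace V] (θ : X → X) (μ : Measure X)
    (α : ι → Set X) (κ : X → Equiv.Perm V) : Prop :=
  ∀ (i j : ι) (v w : V), ∃ n : ℕ, 0 < n ∧
    0 < (μ.prod Measure.count)
      (((extension θ κ)^[n] '' (α i ×ˢ ({v} : Set V))) ∩ (α j ×ˢ ({w} : Set V)))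

/-- The exponential return rate `R(T, o) = limsup μ {x | κⁿ_x o = o} ^ (1/n)`. -/
def returnRate [MeasurableSpace X] (θ : X → X) (μ : Measure X) (κ : X → Equiv.Perm V)
    (o : V) : ℝ≥0∞ :=
  limsup (fun n : ℕ => μ {x | iterCocycle θ κ n x o = o} ^ (1 / (n : ℝ))) atTop

/-- Weak symmetry of the extension. -/
def IsSymmetricExtension [MeasurableSpace X] (θ : X → X) (μ : Measure X)
    (κ : X → Equiv.Perm V) : Prop :=
  ∃ (C : ℕ → ℝ) (N : ℕ → ℕ), (∀ n, 0 < C n) ∧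
    Tendsto (fun n : ℕ => C n ^ (1 / (n : ℝ))) atTop (𝓝 1) ∧
    Tendsto (fun n : ℕ => (N n : ℝ) / n) atTop (𝓝 0) ∧
    ∀ n : ℕ, 0 < n → ∀ v w : V,
      μ.real {x | iterCocycle θ κ n x v = w} ≤
        C n * ∑ k ∈ Finset.Icc (n - N n) (n + N n), μ.real {x | iterCocycle θ κ k x w = v}

/-- The Banach space `𝓗_∞` of (classes of) functions `f` on `X × V` with
`‖f‖² = ∑_v ‖f(·, v)‖_{L^∞(μ)}² < ∞`, with complex scalars, as is needed for the spectrum. -/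
abbrev HInfty [MeasurableSpace X] (V : Type*) (μ : Measure X) : Type _ :=
  lp (fun _ : V => Lp ℂ ∞ μ) 2

/-- An element of `𝓗_∞` as a function on `X × V`. -/
def HInfty.toFun [MeasurableSpace X] {μ : Measure X} (g : HInfty V μ) (p : X × V) : ℂ :=
  (g p.2 : X → ℂ) p.1

/-- The bounded operator `L` on `𝓗_∞` is the transfer operator of the extension `T`: for each
`g ∈ 𝓗_∞ ∩ L¹(Y)` one has `L g ∈ L¹(Y)` and `∫ (f ∘ T) g = ∫ f (L g)` for all bounded measurable
`f`, where `Y = X × V` carries the product of `μ` and the counting measure. Functions with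
finitely many non-zero fibres are dense in `𝓗_∞` and lie in `L¹(Y)`, so this determines `L`. -/
def IsTransferOperator [MeasurableSpace X] [MeasurableSpace V] (θ : X → X) (μ : Measure X)
    (κ : X → Equiv.Perm V) (L : HInfty V μ →L[ℂ] HInfty V μ) : Prop :=
  ∀ g : HInfty V μ, Integrable (HInfty.toFun g) (μ.prod Measure.count) →
    Integrable (HInfty.toFun (L g)) (μ.prod Measure.count) ∧
    ∀ f : X × V → ℂ, Measurable f → (∃ M : ℝ, ∀ p, ‖f p‖ ≤ M) →
      ∫ p, f (extension θ κ p) * HInfty.toFun g p ∂(μ.prod Measure.count) =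
        ∫ p, f p * HInfty.toFun (L g) p ∂(μ.prod Measure.count)

end GraphExtension

end

/-! Everything is controlled by the kernel P_n(v, w) = μ{κⁿ_x v = w} (`transition`). The event κⁿ_x
v = w is a union of n-cylinders, and bounded distortion makes the Jacobian of each inverse branch
comparable to the measure of its cylinder, uniformly in the word. As all branches are full, the
first n steps and the future after time n are independent up to a constant factor K
(`quasiIndependent_of_branchJacobian_bounds`). Hence P_n P_m ≤ K P_{n+m} entrywise; with
transitivity, this makes the return rate R independent of the vertex.

The transfer operator is a sum over cells of weighted composition operators which permute the
fibres; their norms are at most K μ(α i), so the sum converges (`exists_isTransferOperator`).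
Duality gives two bounds on its powers. Testing on the constant 1 in the fibre over o yields P_n(o,
o) ≤ ‖Lⁿ‖, hence R ≤ ρ. Conversely, the sup norms of the fibres of Lⁿ g are dominated by K times the
transpose of P_n applied to those of g (`IsTransferOperator.enorm_pow_apply_le`), so ‖Lⁿ‖ is at most
K times an ℓ² operator norm, estimated by a Schur test for P_n P_nᵀ
(`IsTransferOperator.enorm_pow_le`).

With the constant test function, double stochasticity of P_n (each κ_x is a bijection) gives ‖Lⁿ‖ ≤
K, hence ρ ≤ 1. In the symmetric case the test function is the Green function ∑ P_l(o, ·) s⁻ˡ with R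
< s ≤ 1. Symmetry turns P_n P_nᵀ into a sum of products P_n P_k with k near n, and each of these
multiplies the Green function by at most a constant times sⁿ⁺ᵏ (`tsum_green_le_of_symmetric`). The
losses are subexponential, so ρ ≤ R. -/

noncomputable section

namespace GraphExtension

section

/-! ### Itineraries and the iterated cocycle -/

section Basic

variable {X ι V : Type*} {θ : X → X} {α : ι → Set X} {G : Digraph V} {κ : X → Equiv.Perm V}

lemma mem_cylinder_cons {i : ι} {w : List ι} {x : X} :
    x ∈ cylinder θ α (i :: w) ↔ x ∈ α i ∧ θ x ∈ cylinder θ α w := Iff.rfl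

lemma cylinder_cons_inter_preimage (i : ι) (w : List ι) (B : Set X) :
    cylinder θ α (i :: w) ∩ θ^[(i :: w).length] ⁻¹' B
      = α i ∩ θ ⁻¹' (cylinder θ α w ∩ θ^[w.length] ⁻¹' B) := by
  ext x
  simp [mem_cylinder_cons, and_assoc]

lemma symbolicDist_le_one {r : ℝ} (hr : r ∈ Set.Ioo (0 : ℝ) 1) (x y : X) :
    symbolicDist θ α r x y ≤ 1 := by
  unfold symbolicDist
  split_ifs
  · exact pow_le_one₀ hr.1.le hr.2.le
  · exact zero_le_one

lemma iterCocycle_succ_apply (n : ℕ) (x : X) (v : V) :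
    iterCocycle θ κ (n + 1) x v = κ (θ^[n] x) (iterCocycle θ κ n x v) := rfl

lemma iterCocycle_add_apply (n m : ℕ) (x : X) (v : V) :
    iterCocycle θ κ (n + m) x v = iterCocycle θ κ m (θ^[n] x) (iterCocycle θ κ n x v) := by
  induction m with
  | zero => simp [iterCocycle]
  | succ m ih =>
    rw [← add_assoc, iterCocycle_succ_apply, ih, iterCocycle_succ_apply, add_comm n m,
      Function.iterate_add_apply]

lemma extension_iterate (n : ℕ) (p : X × V) :
    (extension θ κ)^[n] p = (θ^[n] p.1, iterCocycle θ κ n p.1 p.2) := by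
  induction n with
  | zero => rfl
  | succ n ih =>
    rw [Function.iterate_succ_apply', ih, extension, iterCocycle_succ_apply,
      Function.iterate_succ_apply']

lemma iterCocycle_eq_of_mem_cylinder (hκ : IsNearestNeighbourCocycle α G κ) {w : List ι} {x y : X}
    (hx : x ∈ cylinder θ α w) (hy : y ∈ cylinder θ α w) (v : V) :
    iterCocycle θ κ w.length x v = iterCocycle θ κ w.length y v := by
  induction w generalizing x y v with
  | nil => rfl
  | cons i w ih =>
    rw [List.length_cons, add_comm, iterCocycle_add_apply, iterCocycle_add_apply]
    have h1 : iterCocycle θ κ 1 x v = iterCocycle θ κ 1 y v := by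
      simp [iterCocycle, hκ.const i x hx.1 y hy.1]
    rw [h1]
    exact ih hx.2 hy.2 _

end Basic

variable {X ι V : Type*} [MeasurableSpace X] {θ : X → X} {μ : Measure X} {α : ι → Set X}

/-! ### Cylinders and bounded distortion -/

section Cylinders

namespace IsMarkovMap

lemma measurableSet_cylinder (hθ : IsMarkovMap θ μ α) (w : List ι) :
    MeasurableSet (cylinder θ α w) := by
  induction w with
  | nil => exact MeasurableSet.univ
  | cons i w ih => exact (hθ.measurable_cell i).inter (hθ.measurable_map ih)

lemma measurable_iterate (hθ : IsMarkovMap θ μ α) (n : ℕ) : Measurable (θ^[n]) :=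
  hθ.measurable_map.iterate n

lemma exists_mem_cell (hθ : IsMarkovMap θ μ α) (x : X) : ∃ i, x ∈ α i := by
  have : x ∈ ⋃ i, α i := hθ.cover ▸ Set.mem_univ x
  simpa using this

lemma eq_of_mem_cell (hθ : IsMarkovMap θ μ α) {i j : ι} {x : X} (hi : x ∈ α i) (hj : x ∈ α j) :
    i = j := by
  by_contra h
  exact Set.disjoint_left.1 (hθ.disjoint h) hi hj

lemma exists_mem_cylinder (hθ : IsMarkovMap θ μ α) (n : ℕ) (x : X) :
    ∃ w : List ι, w.length = n ∧ x ∈ cylinder θ α w := by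
  induction n generalizing x with
  | zero => exact ⟨[], rfl, Set.mem_univ x⟩
  | succ n ih =>
    obtain ⟨i, hi⟩ := hθ.exists_mem_cell x
    obtain ⟨w, hw, hx⟩ := ih (θ x)
    exact ⟨i :: w, by simp [hw], hi, hx⟩

lemma eq_of_mem_cylinder (hθ : IsMarkovMap θ μ α) {w w' : List ι} (h : w.length = w'.length)
    {x : X} (hx : x ∈ cylinder θ α w) (hx' : x ∈ cylinder θ α w') : w = w' := by
  induction w generalizing w' x with
  | nil => exact (List.length_eq_zero_iff.1 h.symm).symm
  | cons i w ih =>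
    cases w' with
    | nil => simp at h
    | cons j w' =>
      rw [hθ.eq_of_mem_cell hx.1 hx'.1, ih (by simpa using h) hx.2 hx'.2]

end IsMarkovMap

namespace IsFullGibbsMarkovMap

/-- The image of the left-hand set under `θ` is `θ '' α i ∩ B`; fullness of the branch says that
this is `B` up to a null set. -/
lemma measure_cell_inter_preimage_eq_zero_iff (hθ : IsFullGibbsMarkovMap θ μ α) (i : ι)
    {B : Set X} (hB : MeasurableSet B) : μ (α i ∩ θ ⁻¹' B) = 0 ↔ μ B = 0 := by
  rw [← hθ.nonsingular i _ Set.inter_subset_left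
    ((hθ.measurable_cell i).inter (hθ.measurable_map hB)), Set.image_inter_preimage]
  refine ⟨fun h => ?_, fun h => measure_mono_null Set.inter_subset_right h⟩
  refine measure_mono_null (t := (θ '' α i ∩ B) ∪ (θ '' α i)ᶜ) ?_
    (measure_union_null h (hθ.full i))
  intro x hx
  by_cases h' : x ∈ θ '' α i
  · exact Or.inl ⟨h', hx⟩
  · exact Or.inr h'

lemma measure_cylinder_inter_preimage_eq_zero_iff (hθ : IsFullGibbsMarkovMap θ μ α) (w : List ι)
    {B : Set X} (hB : MeasurableSet B) :
    μ (cylinder θ α w ∩ θ^[w.length] ⁻¹' B) = 0 ↔ μ B = 0 := by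
  induction w with
  | nil => simp [cylinder]
  | cons i w ih =>
    rw [cylinder_cons_inter_preimage, hθ.measure_cell_inter_preimage_eq_zero_iff i
      ((hθ.measurableSet_cylinder w).inter (hθ.measurable_iterate _ hB)), ih]

variable [IsProbabilityMeasure μ]

lemma measure_cylinder_pos (hθ : IsFullGibbsMarkovMap θ μ α) (w : List ι) :
    0 < μ (cylinder θ α w) := by
  rw [pos_iff_ne_zero]
  intro h
  have := (hθ.measure_cylinder_inter_preimage_eq_zero_iff w MeasurableSet.univ).1 (by simpa using h)
  simp at this

lemma setLIntegral_branchJacobian (hθ : IsFullGibbsMarkovMap θ μ α) (w : List ι)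
    {B : Set X} (hB : MeasurableSet B) :
    ∫⁻ x in B, branchJacobian θ μ α w x ∂μ = μ (cylinder θ α w ∩ θ^[w.length] ⁻¹' B) := by
  have hm := hθ.measurable_iterate w.length
  unfold branchJacobian
  rw [Measure.setLIntegral_rnDeriv, Measure.map_apply hm hB,
    Measure.restrict_apply (hm hB), Set.inter_comm]
  refine Measure.AbsolutelyContinuous.mk fun s hs h => ?_
  rw [Measure.map_apply hm hs, Measure.restrict_apply (hm hs), Set.inter_comm,
    hθ.measure_cylinder_inter_preimage_eq_zero_iff w hs]
  exact h

lemma measurable_branchJacobian (θ : X → X) (μ : Measure X) (α : ι → Set X) (w : List ι) :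
    Measurable (branchJacobian θ μ α w) :=
  Measure.measurable_rnDeriv _ _

/-- The part of the cylinder mapped into the zero set of the Jacobian is null, hence so is the zero
set by fullness. Positivity and finiteness are needed because `Real.log` of `toReal` vanishes at 0
and ∞, where the distortion bound says nothing. -/
lemma branchJacobian_pos (hθ : IsFullGibbsMarkovMap θ μ α) (w : List ι) :
    ∀ᵐ x ∂μ, 0 < branchJacobian θ μ α w x := by
  have hm := measurable_branchJacobian θ μ α w
  have hN : MeasurableSet {x | branchJacobian θ μ α w x = 0} := hm (measurableSet_singleton 0)
  have h : μ {x | branchJacobian θ μ α w x = 0} = 0 := by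
    rw [← hθ.measure_cylinder_inter_preimage_eq_zero_iff w hN,
      ← hθ.setLIntegral_branchJacobian w hN]
    exact (setLIntegral_congr_fun hN fun x hx => hx).trans (by simp)
  filter_upwards [measure_eq_zero_iff_ae_notMem.1 h] with x hx
  exact pos_iff_ne_zero.2 hx

lemma branchJacobian_lt_top (θ : X → X) (μ : Measure X) [IsFiniteMeasure μ] (α : ι → Set X)
    (w : List ι) : ∀ᵐ x ∂μ, branchJacobian θ μ α w x < ∞ :=
  Measure.rnDeriv_lt_top _ _

/-- Bounded distortion: the Jacobians of the inverse branches are constant up to a factor which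
does not depend on the branch. -/
lemma exists_branchJacobian_bounds (hθ : IsFullGibbsMarkovMap θ μ α) :
    ∃ K : ℝ≥0∞, 1 ≤ K ∧ K ≠ ∞ ∧ ∀ w : List ι, ∀ᵐ x ∂μ,
      branchJacobian θ μ α w x ≤ K * μ (cylinder θ α w) ∧
      μ (cylinder θ α w) ≤ K * branchJacobian θ μ α w x := by
  obtain ⟨C, hC, r, hr, hdist⟩ := hθ.distortion
  refine ⟨ENNReal.ofReal (Real.exp C), ?_, ENNReal.ofReal_ne_top, fun w => ?_⟩
  · rw [← ENNReal.ofReal_one]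
    exact ENNReal.ofReal_le_ofReal (Real.one_le_exp hC.le)
  have hint : ∫⁻ x, branchJacobian θ μ α w x ∂μ = μ (cylinder θ α w) := by
    simpa using hθ.setLIntegral_branchJacobian w MeasurableSet.univ
  have key : ∀ᵐ x ∂μ, ∀ᵐ y ∂μ,
      branchJacobian θ μ α w x ≤ ENNReal.ofReal (Real.exp C) * branchJacobian θ μ α w y ∧
      branchJacobian θ μ α w y ≤ ENNReal.ofReal (Real.exp C) * branchJacobian θ μ α w x := by
    -- The distortion hypothesis excludes the empty word, whose Jacobian is 1.
    rcases eq_or_ne w [] with rfl | hw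
    · have h1 : branchJacobian θ μ α ([] : List ι) =ᵐ[μ] fun _ => 1 := by
        simpa [branchJacobian, cylinder] using Measure.rnDeriv_self μ
      have hK : (1 : ℝ≥0∞) ≤ ENNReal.ofReal (Real.exp C) := by
        rw [← ENNReal.ofReal_one]
        exact ENNReal.ofReal_le_ofReal (Real.one_le_exp hC.le)
      filter_upwards [h1] with x hx
      filter_upwards [h1] with y hy
      simp [hx, hy, hK]
    have aux : ∀ a b : ℝ≥0∞, 0 < a → a < ∞ → 0 < b → b < ∞ →
        |Real.log a.toReal - Real.log b.toReal| ≤ C → a ≤ ENNReal.ofReal (Real.exp C) * b := by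
      intro a b ha ha' hb hb' h
      have pa := ENNReal.toReal_pos ha.ne' ha'.ne
      have pb := ENNReal.toReal_pos hb.ne' hb'.ne
      rw [← ENNReal.ofReal_toReal ha'.ne, ← ENNReal.ofReal_toReal hb'.ne,
        ← ENNReal.ofReal_mul (Real.exp_pos C).le]
      apply ENNReal.ofReal_le_ofReal
      rw [← Real.log_le_log_iff pa (by positivity), Real.log_mul (Real.exp_pos C).ne' pb.ne',
        Real.log_exp]
      linarith [le_abs_self (Real.log a.toReal - Real.log b.toReal)]
    filter_upwards [hdist w hw, hθ.branchJacobian_pos w, branchJacobian_lt_top θ μ α w]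
      with x hx hx0 hx1
    filter_upwards [hx, hθ.branchJacobian_pos w, branchJacobian_lt_top θ μ α w] with y hy hy0 hy1
    have hd := hy.trans (mul_le_of_le_one_right hC.le (symbolicDist_le_one hr x y))
    exact ⟨aux _ _ hx0 hx1 hy0 hy1 hd, aux _ _ hy0 hy1 hx0 hx1 (by rwa [abs_sub_comm])⟩
  -- Averaging over `y` replaces the Jacobian at `y` by its mean, the measure of the cylinder.
  filter_upwards [key] with x hx
  constructor
  · have := lintegral_mono_ae (hx.mono fun y hy => hy.1)
    rwa [lintegral_const, measure_univ, mul_one,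
      lintegral_const_mul _ (measurable_branchJacobian θ μ α w), hint] at this
  · have := lintegral_mono_ae (hx.mono fun y hy => hy.2)
    rwa [lintegral_const, measure_univ, mul_one, hint] at this

end IsFullGibbsMarkovMap

end Cylinders

/-! ### Quasi-independence of the cocycle and the future -/

section Cocycle

variable {G : Digraph V} {κ : X → Equiv.Perm V}

/-- The transition kernel `P_n(v, w) = μ {x | κⁿ_x v = w}`. -/
def transition (θ : X → X) (μ : Measure X) (κ : X → Equiv.Perm V) (n : ℕ) (v w : V) : ℝ≥0∞ :=
  μ {x | iterCocycle θ κ n x v = w}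

/-- A single point that moves `v` to `w` suffices: the cocycle is constant on its n-cylinder, which
has positive measure. -/
lemma exists_transition_pos [IsProbabilityMeasure μ] [MeasurableSpace V]
    (hθ : IsFullGibbsMarkovMap θ μ α)
    (hκ : IsNearestNeighbourCocycle α G κ) (hT : IsTransitiveExtension θ μ α κ) (v w : V) :
    ∃ n, 0 < transition θ μ κ n v w := by
  obtain ⟨x₀⟩ : Nonempty X := nonempty_of_isProbabilityMeasure μ
  obtain ⟨i, hi⟩ := hθ.exists_mem_cell x₀
  obtain ⟨n, -, h⟩ := hT i i v w
  obtain ⟨q, ⟨⟨x, v'⟩, ⟨hx, rfl⟩, rfl⟩, hq⟩ := nonempty_of_measure_ne_zero h.ne'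
  rw [extension_iterate] at hq
  have hxw : iterCocycle θ κ n x v' = w := hq.2
  obtain ⟨u, rfl, hxu⟩ := hθ.exists_mem_cylinder n x
  refine ⟨u.length, (hθ.measure_cylinder_pos u).trans_le (measure_mono fun y hy => ?_)⟩
  exact (iterCocycle_eq_of_mem_cylinder hκ hy hxu _).trans hxw

/-- The event `κⁿ_x v = w` is a union of cylinders of length `n`. -/
lemma setOf_iterCocycle_eq (hθ : IsMarkovMap θ μ α) (hκ : IsNearestNeighbourCocycle α G κ)
    (n : ℕ) (v w : V) : {x | iterCocycle θ κ n x v = w} =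
      ⋃ u ∈ {u : List ι | u.length = n ∧ ∃ y ∈ cylinder θ α u, iterCocycle θ κ n y v = w},
        cylinder θ α u := by
  ext x
  simp only [Set.mem_ofPred_eq, Set.mem_iUnion, exists_prop]
  constructor
  · intro h
    obtain ⟨u, hu, hx⟩ := hθ.exists_mem_cylinder n x
    exact ⟨u, ⟨hu, x, hx, h⟩, hx⟩
  · rintro ⟨u, ⟨rfl, y, hy, h⟩, hx⟩
    rw [iterCocycle_eq_of_mem_cylinder hκ hx hy, h]

variable [Countable ι]

lemma measurableSet_iterCocycle_eq (hθ : IsMarkovMap θ μ α)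
    (hκ : IsNearestNeighbourCocycle α G κ) (n : ℕ) (v w : V) :
    MeasurableSet {x | iterCocycle θ κ n x v = w} := by
  rw [setOf_iterCocycle_eq hθ hκ]
  exact MeasurableSet.biUnion (Set.to_countable _) fun u _ => hθ.measurableSet_cylinder u

lemma measure_iterCocycle_eq_inter (hθ : IsMarkovMap θ μ α)
    (hκ : IsNearestNeighbourCocycle α G κ) (n : ℕ) (v w : V) {B : Set X} (hB : MeasurableSet B) :
    μ ({x | iterCocycle θ κ n x v = w} ∩ B) =
      ∑' u : {u : List ι | u.length = n ∧ ∃ y ∈ cylinder θ α u, iterCocycle θ κ n y v = w},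
        μ (cylinder θ α u ∩ B) := by
  rw [setOf_iterCocycle_eq hθ hκ, Set.iUnion₂_inter, measure_biUnion (Set.to_countable _)]
  · intro u hu u' hu' h
    refine Set.disjoint_left.2 fun x hx hx' => h ?_
    exact hθ.eq_of_mem_cylinder (hu.1.trans hu'.1.symm) hx.1 hx'.1
  · exact fun u _ => (hθ.measurableSet_cylinder u).inter hB

/-- The first `n` steps of the cocycle and the future after time `n` are independent up to the
factor `K`. -/
def QuasiIndependent (θ : X → X) (μ : Measure X) (κ : X → Equiv.Perm V) (K : ℝ≥0∞) : Prop :=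
  ∀ (n : ℕ) (v w : V) (B : Set X), MeasurableSet B →
    μ ({x | iterCocycle θ κ n x v = w} ∩ θ^[n] ⁻¹' B) ≤ K * (transition θ μ κ n v w * μ B) ∧
    transition θ μ κ n v w * μ B ≤ K * μ ({x | iterCocycle θ κ n x v = w} ∩ θ^[n] ⁻¹' B)

variable [IsProbabilityMeasure μ]

lemma quasiIndependent_of_branchJacobian_bounds (hθ : IsFullGibbsMarkovMap θ μ α)
    (hκ : IsNearestNeighbourCocycle α G κ) {K : ℝ≥0∞}
    (hK : ∀ w : List ι, ∀ᵐ x ∂μ, branchJacobian θ μ α w x ≤ K * μ (cylinder θ α w) ∧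
      μ (cylinder θ α w) ≤ K * branchJacobian θ μ α w x) :
    QuasiIndependent θ μ κ K := by
  intro n v w B hB
  have hB' := hθ.measurable_iterate n hB
  have hP : transition θ μ κ n v w =
      ∑' u : {u : List ι | u.length = n ∧ ∃ y ∈ cylinder θ α u, iterCocycle θ κ n y v = w},
        μ (cylinder θ α u) := by
    simpa [transition] using measure_iterCocycle_eq_inter hθ.toIsMarkovMap hκ n v w MeasurableSet.univ
  rw [hP, measure_iterCocycle_eq_inter hθ.toIsMarkovMap hκ n v w hB', ← ENNReal.tsum_mul_right,
    ← ENNReal.tsum_mul_left, ← ENNReal.tsum_mul_left]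
  constructor
  · refine ENNReal.tsum_le_tsum fun u => ?_
    obtain ⟨u, rfl, hu⟩ := u
    rw [← hθ.setLIntegral_branchJacobian u hB]
    calc _ ≤ ∫⁻ _ in B, K * μ (cylinder θ α u) ∂μ :=
          lintegral_mono_ae (ae_restrict_of_ae ((hK u).mono fun x hx => hx.1))
      _ = _ := by simp [mul_assoc]
  · refine ENNReal.tsum_le_tsum fun u => ?_
    obtain ⟨u, rfl, hu⟩ := u
    rw [← hθ.setLIntegral_branchJacobian u hB,
      ← lintegral_const_mul _ (IsFullGibbsMarkovMap.measurable_branchJacobian θ μ α u)]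
    calc _ = ∫⁻ _ in B, μ (cylinder θ α u) ∂μ := by simp
      _ ≤ _ := lintegral_mono_ae (ae_restrict_of_ae ((hK u).mono fun x hx => hx.2))

end Cocycle

/-! ### Double stochasticity and supermultiplicativity of the kernel -/

section Transition

variable {G : Digraph V} {κ : X → Equiv.Perm V} [Countable ι] [Countable V]

lemma tsum_transition [IsProbabilityMeasure μ] (hθ : IsMarkovMap θ μ α)
    (hκ : IsNearestNeighbourCocycle α G κ) (n : ℕ) (v : V) :
    ∑' w, transition θ μ κ n v w = 1 := by
  rw [← measure_univ (μ := μ)]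
  have : (Set.univ : Set X) = ⋃ w, {x | iterCocycle θ κ n x v = w} := by ext; simp
  rw [this, measure_iUnion _ fun w => measurableSet_iterCocycle_eq hθ hκ n v w]
  · rfl
  · exact fun w w' h => Set.disjoint_left.2 fun x hx hx' => h (hx.symm.trans hx')

/-- Bijectivity of the cocycle enters here: every point has exactly one starting vertex which is
moved to `w`. -/
lemma tsum_transition' [IsProbabilityMeasure μ] (hθ : IsMarkovMap θ μ α)
    (hκ : IsNearestNeighbourCocycle α G κ) (n : ℕ) (w : V) :
    ∑' v, transition θ μ κ n v w = 1 := by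
  rw [← measure_univ (μ := μ)]
  have : (Set.univ : Set X) = ⋃ v, {x | iterCocycle θ κ n x v = w} := by
    ext x
    simpa using ⟨(iterCocycle θ κ n x).symm w, by simp⟩
  rw [this, measure_iUnion _ fun v => measurableSet_iterCocycle_eq hθ hκ n v w]
  · rfl
  · exact fun v v' h => Set.disjoint_left.2 fun x hx hx' =>
      h ((iterCocycle θ κ n x).injective (hx.trans hx'.symm))

lemma transition_add (hθ : IsMarkovMap θ μ α) (hκ : IsNearestNeighbourCocycle α G κ)
    (n m : ℕ) (v w : V) : transition θ μ κ (n + m) v w =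
      ∑' u, μ ({x | iterCocycle θ κ n x v = u} ∩ θ^[n] ⁻¹' {x | iterCocycle θ κ m x u = w}) := by
  have : {x | iterCocycle θ κ (n + m) x v = w} =
      ⋃ u, {x | iterCocycle θ κ n x v = u} ∩ θ^[n] ⁻¹' {x | iterCocycle θ κ m x u = w} := by
    ext x
    simp [iterCocycle_add_apply]
  rw [transition, this, measure_iUnion]
  · exact fun u u' h => Set.disjoint_left.2 fun x hx hx' => h (hx.1.symm.trans hx'.1)
  · exact fun u => (measurableSet_iterCocycle_eq hθ hκ n v u).inter
      (hθ.measurable_iterate n (measurableSet_iterCocycle_eq hθ hκ m u w))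

lemma QuasiIndependent.tsum_mul_le {K : ℝ≥0∞} (hK : QuasiIndependent θ μ κ K)
    (hθ : IsMarkovMap θ μ α) (hκ : IsNearestNeighbourCocycle α G κ) (n m : ℕ) (v w : V) :
    ∑' u, transition θ μ κ n v u * transition θ μ κ m u w
      ≤ K * transition θ μ κ (n + m) v w := by
  rw [transition_add hθ hκ, ← ENNReal.tsum_mul_left]
  exact ENNReal.tsum_le_tsum fun u =>
    (hK n v u _ (measurableSet_iterCocycle_eq hθ hκ m u w)).2

lemma QuasiIndependent.transition_mul_le {K : ℝ≥0∞} (hK : QuasiIndependent θ μ κ K)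
    (hθ : IsMarkovMap θ μ α) (hκ : IsNearestNeighbourCocycle α G κ) (n m : ℕ) (v u w : V) :
    transition θ μ κ n v u * transition θ μ κ m u w ≤ K * transition θ μ κ (n + m) v w :=
  (ENNReal.le_tsum u).trans (hK.tsum_mul_le hθ hκ n m v w)

end Transition

end

section

/-! ### The Schur test on ℓ² -/

section Schur

lemma two_mul_mul_le_sq_mul_add_sq_mul_inv {x : ℝ≥0∞} (hx : x ≠ 0) (hx' : x ≠ ∞) (a b : ℝ≥0∞) :
    2 * (a * b) ≤ a ^ 2 * x + b ^ 2 * x⁻¹ := by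
  rcases eq_or_ne a ∞ with rfl | ha
  · simp [ENNReal.top_mul hx]
  rcases eq_or_ne b ∞ with rfl | hb
  · simp [ENNReal.top_mul (ENNReal.inv_ne_zero.2 hx')]
  lift x to NNReal using hx'
  lift a to NNReal using ha
  lift b to NNReal using hb
  have hx0 : x ≠ 0 := by exact_mod_cast hx
  rw [← ENNReal.coe_inv hx0]
  norm_cast
  have hpos : (0 : ℝ) < x := by positivity
  rw [← NNReal.coe_le_coe]
  push_cast
  have : (a : ℝ) ^ 2 * x + (b : ℝ) ^ 2 * (x : ℝ)⁻¹ - 2 * (a * b) = (a * x - b) ^ 2 * (x : ℝ)⁻¹ := by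
    field_simp
    ring
  have h2 : 0 ≤ ((a : ℝ) * x - b) ^ 2 * (x : ℝ)⁻¹ := by positivity
  linarith

/-- The Schur test for the positive kernel `P Pᵀ`. -/
lemma tsum_sq_le_of_schur {V : Type*} {P : V → V → ℝ≥0∞} {h : V → ℝ≥0∞} (h0 : ∀ v, h v ≠ 0)
    (h1 : ∀ v, h v ≠ ∞) {M : ℝ≥0∞}
    (hM : ∀ v, ∑' v', (∑' w, P v w * P v' w) * h v' ≤ M * h v) (f : V → ℝ≥0∞) :
    ∑' w, (∑' v, P v w * f v) ^ 2 ≤ M * ∑' v, f v ^ 2 := by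
  set S : V → V → ℝ≥0∞ := fun v v' => ∑' w, P v w * P v' w with hS
  have hsymm : ∀ v v', S v v' = S v' v := fun v v' => by simp_rw [hS, mul_comm]
  have e1 : ∑' w, (∑' v, P v w * f v) ^ 2 = ∑' v, ∑' v', S v v' * (f v * f v') := by
    have : ∀ w, (∑' v, P v w * f v) ^ 2 = ∑' v, ∑' v', P v w * f v * (P v' w * f v') := fun w => by
      rw [sq, ← ENNReal.tsum_mul_right]
      exact tsum_congr fun v => ENNReal.tsum_mul_left.symm
    simp_rw [this]
    rw [ENNReal.tsum_comm]
    refine tsum_congr fun v => ?_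
    rw [ENNReal.tsum_comm]
    refine tsum_congr fun v' => ?_
    rw [hS, ← ENNReal.tsum_mul_right]
    exact tsum_congr fun w => by ring
  have e2 : ∑' v, ∑' v', S v v' * (f v ^ 2 * (h v' / h v)) ≤ M * ∑' v, f v ^ 2 := by
    rw [← ENNReal.tsum_mul_left]
    refine ENNReal.tsum_le_tsum fun v => ?_
    calc ∑' v', S v v' * (f v ^ 2 * (h v' / h v))
        = (∑' v', S v v' * h v') * (f v ^ 2 / h v) := by
          rw [← ENNReal.tsum_mul_right]
          exact tsum_congr fun v' => by simp only [div_eq_mul_inv]; ring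
      _ ≤ M * h v * (f v ^ 2 / h v) := by gcongr; exact hM v
      _ = M * f v ^ 2 := by
          rw [mul_assoc, ENNReal.mul_div_cancel (h0 v) (h1 v)]
  have e3 : ∑' v, ∑' v', S v v' * (f v' ^ 2 * (h v / h v')) ≤ M * ∑' v, f v ^ 2 := by
    rw [ENNReal.tsum_comm]
    simpa only [hsymm] using e2
  -- The weight h(v')/h(v) in the arithmetic-geometric inequality splits the quadratic form of S = P
  -- Pᵀ into `e2` and its mirror image `e3`.
  have e4 : 2 * ∑' v, ∑' v', S v v' * (f v * f v') ≤ 2 * (M * ∑' v, f v ^ 2) := by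
    rw [two_mul (M * _), ← ENNReal.tsum_mul_left]
    refine le_trans ?_ (add_le_add e2 e3)
    rw [← ENNReal.tsum_add]
    refine ENNReal.tsum_le_tsum fun v => ?_
    rw [← ENNReal.tsum_mul_left, ← ENNReal.tsum_add]
    refine ENNReal.tsum_le_tsum fun v' => ?_
    rw [← mul_add, mul_left_comm]
    gcongr
    have := two_mul_mul_le_sq_mul_add_sq_mul_inv (x := h v' / h v)
      (ENNReal.div_ne_zero.2 ⟨h0 v', h1 v⟩) (ENNReal.div_ne_top (h1 v') (h0 v)) (f v) (f v')
    rwa [ENNReal.inv_div (Or.inl (h1 v)) (Or.inl (h0 v))] at this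
  rw [e1]
  exact (ENNReal.mul_le_mul_iff_right (by simp) (by simp)).1 e4

end Schur

/-! ### Exponential rates and the Green function -/

section Rates

lemma tendsto_const_rpow_one_div {D : ℝ≥0∞} (h0 : D ≠ 0) (h1 : D ≠ ∞) :
    Tendsto (fun n : ℕ => D ^ (1 / (n : ℝ))) atTop (𝓝 1) := by
  lift D to NNReal using h1
  have h0' : D ≠ 0 := by exact_mod_cast h0
  have : Tendsto (fun n : ℕ => D ^ (1 / (n : ℝ))) atTop (𝓝 (D ^ (0 : ℝ))) :=
    ((NNReal.continuousAt_rpow (x := D) (y := 0) (Or.inl h0')).comp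
      (f := fun y : ℝ => (D, y)) (by fun_prop)).tendsto.comp tendsto_one_div_atTop_nhds_zero_nat
  rw [NNReal.rpow_zero] at this
  refine (ENNReal.tendsto_coe.2 this).congr fun n => ?_
  exact ENNReal.coe_rpow_of_ne_zero h0' _

lemma limsup_rpow_one_div_le {b : ℕ → ℝ≥0∞} {D s : ℝ≥0∞} (hD : D ≠ ∞)
    (h : ∀ᶠ n in atTop, b n ≤ D * s ^ n) :
    limsup (fun n : ℕ => b n ^ (1 / (n : ℝ))) atTop ≤ s := by
  -- `D + 1` replaces `D` because the n-th roots tend to 1 only for a non-zero constant.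
  have h1 : Tendsto (fun n : ℕ => (D + 1) ^ (1 / (n : ℝ)) * s) atTop (𝓝 (1 * s)) :=
    ENNReal.Tendsto.mul_const (tendsto_const_rpow_one_div (by simp) (by simp [hD]))
      (Or.inl one_ne_zero)
  rw [one_mul] at h1
  rw [← h1.limsup_eq]
  refine limsup_le_limsup ?_
  filter_upwards [h, eventually_gt_atTop 0] with n hn hn0
  calc b n ^ (1 / (n : ℝ)) ≤ ((D + 1) * s ^ n) ^ (1 / (n : ℝ)) := by
        refine ENNReal.rpow_le_rpow (hn.trans ?_) (by positivity)
        gcongr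
        exact le_self_add
    _ = _ := by
        rw [ENNReal.mul_rpow_of_nonneg _ _ (by positivity), ← ENNReal.rpow_natCast,
          ← ENNReal.rpow_mul, mul_one_div_cancel (by positivity), ENNReal.rpow_one]

lemma eventually_le_pow_of_limsup_lt {a : ℕ → ℝ≥0∞} {s : ℝ≥0∞}
    (h : limsup (fun n : ℕ => a n ^ (1 / (n : ℝ))) atTop < s) :
    ∀ᶠ n in atTop, a n ≤ s ^ n := by
  filter_upwards [eventually_lt_of_limsup_lt h, eventually_gt_atTop 0] with n hn hn0
  have hn0' : (0 : ℝ) < n := by positivity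
  rw [← ENNReal.rpow_natCast]
  rw [one_div] at hn
  exact (ENNReal.rpow_inv_le_iff hn0').1 hn.le

variable {X ι V : Type*} [MeasurableSpace X] {θ : X → X} {μ : Measure X} {α : ι → Set X}
  {G : Digraph V} {κ : X → Equiv.Perm V}

lemma transition_le_one [IsProbabilityMeasure μ] (n : ℕ) (v w : V) : transition θ μ κ n v w ≤ 1 := prob_le_one

lemma returnRate_eq (o : V) : returnRate θ μ κ o =
    limsup (fun n : ℕ => transition θ μ κ n o o ^ (1 / (n : ℝ))) atTop := rfl

variable {K : ℝ≥0∞}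

/-- Prefixing a passage from `o` to `v` and appending one from `w` to `o`, both of positive
probability, turns a transition into a return to `o`, at the cost of a constant factor and a fixed
delay. -/
lemma eventually_transition_le [IsProbabilityMeasure μ] [MeasurableSpace V] [Countable ι] [Countable V]
    (hK : QuasiIndependent θ μ κ K) (hK' : K ≠ ∞)
    (hθ : IsFullGibbsMarkovMap θ μ α) (hκ : IsNearestNeighbourCocycle α G κ)
    (hT : IsTransitiveExtension θ μ α κ) (o v w : V) {s : ℝ≥0∞} (hs : s ≠ ∞)
    (h : returnRate θ μ κ o < s) :
    ∃ A : ℝ≥0∞, A ≠ ∞ ∧ ∀ᶠ n in atTop, transition θ μ κ n v w ≤ A * s ^ n := by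
  obtain ⟨k, hk⟩ := exists_transition_pos hθ hκ hT o v
  obtain ⟨m, hm⟩ := exists_transition_pos hθ hκ hT w o
  set c := transition θ μ κ k o v
  set d := transition θ μ κ m w o
  have hc : c ≠ ∞ := ((transition_le_one k o v).trans_lt ENNReal.one_lt_top).ne
  have hd : d ≠ ∞ := ((transition_le_one m w o).trans_lt ENNReal.one_lt_top).ne
  refine ⟨(c * d)⁻¹ * (K * K * s ^ (k + m)), ?_, ?_⟩
  · exact ENNReal.mul_ne_top (ENNReal.inv_ne_top.2 (mul_ne_zero hk.ne' hm.ne'))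
      (ENNReal.mul_ne_top (ENNReal.mul_ne_top hK' hK') (ENNReal.pow_ne_top hs))
  have h' := (tendsto_add_atTop_nat (k + m)).eventually
    (eventually_le_pow_of_limsup_lt (returnRate_eq (θ := θ) (μ := μ) (κ := κ) o ▸ h))
  filter_upwards [h'] with n hn
  have h1 : c * transition θ μ κ n v w * d ≤ K * K * s ^ (n + (k + m)) :=
    calc c * transition θ μ κ n v w * d
        ≤ K * transition θ μ κ (k + n) o w * d := by
          exact mul_le_mul_left (hK.transition_mul_le hθ.toIsMarkovMap hκ k n o v w) d
      _ ≤ K * (K * transition θ μ κ (k + n + m) o o) := by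
          rw [mul_assoc]
          exact mul_le_mul_right (hK.transition_mul_le hθ.toIsMarkovMap hκ (k + n) m o w o) K
      _ ≤ _ := by
          rw [← mul_assoc, show k + n + m = n + (k + m) by ring]
          gcongr
  have h2 : transition θ μ κ n v w = (c * d)⁻¹ * (c * transition θ μ κ n v w * d) := by
    rw [show c * transition θ μ κ n v w * d = (c * d) * transition θ μ κ n v w by ring,
      ← mul_assoc, ENNReal.inv_mul_cancel (mul_ne_zero hk.ne' hm.ne') (ENNReal.mul_ne_top hc hd),
      one_mul]
  rw [h2]
  calc _ ≤ (c * d)⁻¹ * (K * K * s ^ (n + (k + m))) := by gcongr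
    _ = _ := by rw [pow_add]; ring

lemma returnRate_le_returnRate [IsProbabilityMeasure μ] [MeasurableSpace V] [Countable ι] [Countable V]
    (hK : QuasiIndependent θ μ κ K) (hK' : K ≠ ∞)
    (hθ : IsFullGibbsMarkovMap θ μ α) (hκ : IsNearestNeighbourCocycle α G κ)
    (hT : IsTransitiveExtension θ μ α κ) (o o' : V) :
    returnRate θ μ κ o' ≤ returnRate θ μ κ o := by
  refine le_of_forall_gt_imp_ge_of_dense fun s hs => ?_
  rcases eq_or_ne s ∞ with rfl | hs'
  · exact le_top
  obtain ⟨A, hA, h⟩ := eventually_transition_le hK hK' hθ hκ hT o o' o' hs' hs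
  exact limsup_rpow_one_div_le hA h

/-- The Green function `∑ₗ P_l(o, v) s⁻ˡ`. -/
def green (θ : X → X) (μ : Measure X) (κ : X → Equiv.Perm V) (s : ℝ≥0∞) (o v : V) : ℝ≥0∞ :=
  ∑' l : ℕ, transition θ μ κ l o v * s⁻¹ ^ l

lemma green_ne_zero [IsProbabilityMeasure μ] [MeasurableSpace V] (hθ : IsFullGibbsMarkovMap θ μ α) (hκ : IsNearestNeighbourCocycle α G κ)
    (hT : IsTransitiveExtension θ μ α κ) {s : ℝ≥0∞} (hs : s ≠ ∞) (o v : V) :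
    green θ μ κ s o v ≠ 0 := by
  obtain ⟨n, hn⟩ := exists_transition_pos hθ hκ hT o v
  intro h
  have := ENNReal.tsum_eq_zero.1 h n
  simp [hn.ne', hs] at this

/-- For s' strictly between the return rate and `s`, the tail is dominated by a geometric series of
ratio s'/s. -/
lemma green_ne_top [IsProbabilityMeasure μ] [MeasurableSpace V] [Countable ι] [Countable V]
    (hK : QuasiIndependent θ μ κ K) (hK' : K ≠ ∞)
    (hθ : IsFullGibbsMarkovMap θ μ α) (hκ : IsNearestNeighbourCocycle α G κ)
    (hT : IsTransitiveExtension θ μ α κ) {s : ℝ≥0∞} (o v : V)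
    (h : returnRate θ μ κ o < s) : green θ μ κ s o v ≠ ∞ := by
  obtain ⟨s', hs1, hs2⟩ := exists_between h
  have hs0 : s ≠ 0 := ((zero_le).trans_lt hs2).ne'
  obtain ⟨A, hA, hev⟩ := eventually_transition_le hK hK' hθ hκ hT o o v hs2.ne_top hs1
  obtain ⟨n, hn⟩ := eventually_atTop.1 hev
  have hlt : s' * s⁻¹ < 1 := by
    rw [← div_eq_mul_inv]
    exact ENNReal.div_lt_of_lt_mul (by simpa using hs2)
  have hfin : ∀ l, transition θ μ κ l o v * s⁻¹ ^ l ≠ ∞ := fun l =>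
    ENNReal.mul_ne_top ((transition_le_one l o v).trans_lt ENNReal.one_lt_top).ne
      (ENNReal.pow_ne_top (ENNReal.inv_ne_top.2 hs0))
  rw [green, ← Summable.sum_add_tsum_nat_add' (k := n) ENNReal.summable]
  refine ENNReal.add_ne_top.2 ⟨ENNReal.sum_ne_top.2 fun l _ => hfin l, ?_⟩
  have hle : ∑' l, transition θ μ κ (l + n) o v * s⁻¹ ^ (l + n)
      ≤ ∑' l : ℕ, A * (s' * s⁻¹) ^ n * (s' * s⁻¹) ^ l := by
    refine ENNReal.tsum_le_tsum fun l => ?_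
    calc _ ≤ A * s' ^ (l + n) * s⁻¹ ^ (l + n) := by
          gcongr
          exact hn _ (Nat.le_add_left n l)
      _ = _ := by rw [mul_pow, mul_pow]; ring
  refine ne_top_of_le_ne_top ?_ hle
  rw [ENNReal.tsum_mul_left, ENNReal.tsum_geometric]
  refine ENNReal.mul_ne_top (ENNReal.mul_ne_top hA (ENNReal.pow_ne_top hlt.ne_top)) ?_
  exact ENNReal.inv_ne_top.2 (tsub_pos_of_lt hlt).ne'

/-- Applying P_n shifts the time index of the series by n, up to the factor K; the missing first n
terms only help. -/
lemma tsum_green_mul_transition_le [Countable ι] [Countable V]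
    (hK : QuasiIndependent θ μ κ K)
    (hθ : IsFullGibbsMarkovMap θ μ α) (hκ : IsNearestNeighbourCocycle α G κ)
    {s : ℝ≥0∞} (hs0 : s ≠ 0) (hs : s ≠ ∞) (n : ℕ) (o v : V) :
    ∑' u, green θ μ κ s o u * transition θ μ κ n u v ≤ K * (s ^ n * green θ μ κ s o v) := by
  calc ∑' u, green θ μ κ s o u * transition θ μ κ n u v
      = ∑' l : ℕ, s⁻¹ ^ l * ∑' u, transition θ μ κ l o u * transition θ μ κ n u v := by
        simp_rw [green, ← ENNReal.tsum_mul_right, ← ENNReal.tsum_mul_left]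
        rw [ENNReal.tsum_comm]
        exact tsum_congr fun l => tsum_congr fun u => by ring
    _ ≤ ∑' l : ℕ, K * (s ^ n * (transition θ μ κ (l + n) o v * s⁻¹ ^ (l + n))) := by
        refine ENNReal.tsum_le_tsum fun l => ?_
        calc _ ≤ s⁻¹ ^ l * (K * transition θ μ κ (l + n) o v) := by
              gcongr
              exact hK.tsum_mul_le hθ.toIsMarkovMap hκ l n o v
          _ = K * ((s * s⁻¹) ^ n * (transition θ μ κ (l + n) o v * s⁻¹ ^ l)) := by
              rw [ENNReal.mul_inv_cancel hs0 hs]; ring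
          _ = _ := by rw [mul_pow, pow_add]; ring
    _ ≤ _ := by
        rw [ENNReal.tsum_mul_left, ENNReal.tsum_mul_left]
        gcongr
        exact ENNReal.tsum_comp_le_tsum_of_injective (add_left_injective n)
          (fun l => transition θ μ κ l o v * s⁻¹ ^ l)

/-- Symmetry reverses one of the two factors of P_n P_nᵀ, so that both run in the same direction and
combine into P_{n+k}. The condition `s ≤ 1` allows every sⁿ⁺ᵏ to be bounded by its value at the left
end of the window, which has at most 2N + 1 elements. -/
lemma tsum_green_le_of_symmetric [Countable ι] [Countable V]
    (hK : QuasiIndependent θ μ κ K)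
    (hθ : IsFullGibbsMarkovMap θ μ α) (hκ : IsNearestNeighbourCocycle α G κ)
    {s : ℝ≥0∞} (hs0 : s ≠ 0) (hs : s ≤ 1) {n N : ℕ} {C : ℝ≥0∞}
    (hC : ∀ v w, transition θ μ κ n v w ≤
      C * ∑ k ∈ Finset.Icc (n - N) (n + N), transition θ μ κ k w v) (o v : V) :
    ∑' v', (∑' w, transition θ μ κ n v w * transition θ μ κ n v' w) * green θ μ κ s o v'
      ≤ C * K ^ 2 * (2 * N + 1) * s ^ (n + (n - N)) * green θ μ κ s o v := by
  have hs' : s ≠ ∞ := ne_top_of_le_ne_top ENNReal.one_ne_top hs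
  calc ∑' v', (∑' w, transition θ μ κ n v w * transition θ μ κ n v' w) * green θ μ κ s o v'
      ≤ ∑' v', (∑' w, (C * ∑ k ∈ Finset.Icc (n - N) (n + N), transition θ μ κ k w v) *
          transition θ μ κ n v' w) * green θ μ κ s o v' := by
        gcongr with v' w
        exact hC v w
    _ = ∑' v', (C * ∑ k ∈ Finset.Icc (n - N) (n + N),
          ∑' w, transition θ μ κ n v' w * transition θ μ κ k w v) * green θ μ κ s o v' := by
        refine tsum_congr fun v' => ?_
        rw [← Summable.tsum_finsetSum fun _ _ => ENNReal.summable, ← ENNReal.tsum_mul_left]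
        congr 1
        refine tsum_congr fun w => ?_
        rw [mul_assoc, Finset.sum_mul]
        simp_rw [mul_comm]
    _ ≤ ∑' v', (C * ∑ k ∈ Finset.Icc (n - N) (n + N), K * transition θ μ κ (n + k) v' v) *
          green θ μ κ s o v' := by
        gcongr with v' k
        exact hK.tsum_mul_le hθ.toIsMarkovMap hκ n k v' v
    _ = C * K * ∑ k ∈ Finset.Icc (n - N) (n + N),
          ∑' v', green θ μ κ s o v' * transition θ μ κ (n + k) v' v := by
        rw [← Summable.tsum_finsetSum fun _ _ => ENNReal.summable, ← ENNReal.tsum_mul_left]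
        refine tsum_congr fun v' => ?_
        rw [← Finset.mul_sum, ← Finset.mul_sum]
        ring
    _ ≤ C * K * ∑ k ∈ Finset.Icc (n - N) (n + N),
          K * (s ^ (n + (n - N)) * green θ μ κ s o v) := by
        gcongr with k hk
        refine (tsum_green_mul_transition_le hK hθ hκ hs0 hs' (n + k) o v).trans ?_
        exact mul_le_mul_right (mul_le_mul_left (pow_le_pow_right_of_le_one' hs
          (by have := (Finset.mem_Icc.1 hk).1; omega)) _) _
    _ ≤ _ := by
        rw [Finset.sum_const, Nat.card_Icc, nsmul_eq_mul]
        have : ((n + N + 1 - (n - N) : ℕ) : ℝ≥0∞) ≤ 2 * N + 1 := by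
          norm_cast
          omega
        calc _ ≤ C * K * ((2 * N + 1) * (K * (s ^ (n + (n - N)) * green θ μ κ s o v))) := by gcongr
          _ = _ := by ring

lemma tsum_tsum_transition_mul_transition [IsProbabilityMeasure μ] [Countable ι] [Countable V] (hθ : IsMarkovMap θ μ α)
    (hκ : IsNearestNeighbourCocycle α G κ) (n : ℕ) (v : V) :
    ∑' v', ∑' w, transition θ μ κ n v w * transition θ μ κ n v' w = 1 := by
  rw [ENNReal.tsum_comm]
  simp_rw [ENNReal.tsum_mul_left, tsum_transition' hθ hκ, mul_one, tsum_transition hθ hκ]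

end Rates

end

section

/-! ### Integration on X × V fibre by fibre -/

section ProductWithCount

variable {X V : Type*} [MeasurableSpace X] {μ : Measure X} [SFinite μ] [Countable V]
  [MeasurableSpace V]

lemma prod_count_eq_sum : μ.prod (Measure.count : Measure V) =
    Measure.sum fun v : V => μ.map fun x => (x, v) := by
  simp_rw [Measure.count, Measure.prod_sum_right, Measure.prod_dirac]

variable [MeasurableSingletonClass V]

lemma integrable_prod_count_iff {E : Type*} [NormedAddCommGroup E] {F : X × V → E} :
    Integrable F (μ.prod Measure.count) ↔
      (∀ v, Integrable (fun x => F (x, v)) μ) ∧ Summable fun v => ∫ x, ‖F (x, v)‖ ∂μ := by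
  rw [prod_count_eq_sum, integrable_sum_measure_iff]
  have he (v : V) : MeasurableEmbedding fun x : X => (x, v) := measurableEmbedding_prod_mk_right v
  simp_rw [(he _).integrable_map_iff, (he _).integral_map]
  rfl

lemma hasSum_integral_prod_count {E : Type*} [NormedAddCommGroup E] [NormedSpace ℝ E]
    {F : X × V → E} (hF : Integrable F (μ.prod Measure.count)) :
    HasSum (fun v => ∫ x, F (x, v) ∂μ) (∫ p, F p ∂(μ.prod Measure.count)) := by
  rw [prod_count_eq_sum] at hF ⊢
  have he (v : V) : MeasurableEmbedding fun x : X => (x, v) := measurableEmbedding_prod_mk_right v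
  have := hasSum_integral_measure hF
  simp_rw [(he _).integral_map] at this
  exact this

end ProductWithCount

/-! ### Operators and functionals on L^∞ -/

section LInfty

variable {X : Type*} [MeasurableSpace X] {μ : Measure X}

lemma ae_norm_le_norm (h : Lp ℂ ∞ μ) : ∀ᵐ x ∂μ, ‖h x‖ ≤ ‖h‖ := by
  filter_upwards [ae_le_eLpNormEssSup (f := h) (μ := μ)] with x hx
  rw [← eLpNorm_exponent_top, ← Lp.enorm_def] at hx
  exact enorm_le_iff_norm_le.1 hx

lemma integrable_coeFn_lInfty [IsFiniteMeasure μ] (h : Lp ℂ ∞ μ) : Integrable h μ :=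
  (Lp.memLp h).integrable le_top

/-- Weighted composition operators on `L^∞`. -/
lemma exists_weightedComposition {τ : X → X} (hτ : Measure.QuasiMeasurePreserving τ μ μ)
    {φ : X → ℝ} (hφ : Measurable φ) {c : ℝ} (hc : 0 ≤ c) (hφc : ∀ᵐ x ∂μ, |φ x| ≤ c) :
    ∃ A : Lp ℂ ∞ μ →L[ℂ] Lp ℂ ∞ μ, ‖A‖ ≤ c ∧ ∀ h, A h =ᵐ[μ] fun x => φ x * h (τ x) := by
  have hbd (h : Lp ℂ ∞ μ) : ∀ᵐ x ∂μ, ‖(φ x : ℂ) * h (τ x)‖ ≤ c * ‖h‖ := by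
    filter_upwards [hφc, hτ.ae (ae_norm_le_norm h)] with x h1 h2
    rw [norm_mul, Complex.norm_real, Real.norm_eq_abs]
    gcongr
  have hmem (h : Lp ℂ ∞ μ) : MemLp (fun x => (φ x : ℂ) * h (τ x)) ∞ μ :=
    memLp_top_of_bound ((Complex.measurable_ofReal.comp hφ).aestronglyMeasurable.mul
      ((Lp.aestronglyMeasurable h).comp_quasiMeasurePreserving hτ)) _ (hbd h)
  let A : Lp ℂ ∞ μ →ₗ[ℂ] Lp ℂ ∞ μ :=
    { toFun := fun h => (hmem h).toLp _
      map_add' := fun h k => by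
        rw [← MemLp.toLp_add, MemLp.toLp_eq_toLp_iff]
        filter_upwards [hτ.ae (Lp.coeFn_add h k)] with x hx
        simp only [hx, Pi.add_apply, mul_add]
      map_smul' := fun a h => by
        rw [RingHom.id_apply, ← MemLp.toLp_const_smul, MemLp.toLp_eq_toLp_iff]
        filter_upwards [hτ.ae (Lp.coeFn_smul a h)] with x hx
        simp [hx, mul_left_comm] }
  have hA (h : Lp ℂ ∞ μ) : A h =ᵐ[μ] fun x => φ x * h (τ x) := (hmem h).coeFn_toLp
  have hn (h : Lp ℂ ∞ μ) : ‖A h‖ ≤ c * ‖h‖ := by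
    rw [Lp.norm_def, eLpNorm_exponent_top]
    refine ENNReal.toReal_le_of_le_ofReal (by positivity) (eLpNormEssSup_le_of_ae_bound ?_)
    filter_upwards [hA h, hbd h] with x h1 h2
    rwa [h1]
  exact ⟨A.mkContinuous c hn, A.mkContinuous_norm_le hc hn, hA⟩

/-- Integration against a bounded function as a functional on `L^∞`. -/
lemma exists_integralFunctional [IsProbabilityMeasure μ] {f : X → ℂ} (hf : Measurable f) {M : ℝ}
    (hM : ∀ x, ‖f x‖ ≤ M) :
    ∃ Φ : Lp ℂ ∞ μ →L[ℂ] ℂ, ∀ h, Φ h = ∫ x, f x * h x ∂μ := by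
  have hint (h : Lp ℂ ∞ μ) : Integrable (fun x => f x * h x) μ :=
    (integrable_coeFn_lInfty h).bdd_mul hf.aestronglyMeasurable (ae_of_all _ hM)
  let Φ : Lp ℂ ∞ μ →ₗ[ℂ] ℂ :=
    { toFun := fun h => ∫ x, f x * h x ∂μ
      map_add' := fun h k => by
        rw [← integral_add (hint h) (hint k)]
        refine integral_congr_ae ?_
        filter_upwards [Lp.coeFn_add h k] with x hx
        simp only [hx, Pi.add_apply, mul_add]
      map_smul' := fun a h => by
        rw [RingHom.id_apply, ← integral_smul]
        refine integral_congr_ae ?_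
        filter_upwards [Lp.coeFn_smul a h] with x hx
        simp [hx, mul_left_comm] }
  refine ⟨Φ.mkContinuous M fun h => ?_, fun h => rfl⟩
  have : ∀ᵐ x ∂μ, ‖f x * h x‖ ≤ M * ‖h‖ := by
    filter_upwards [ae_norm_le_norm h] with x hx
    rw [norm_mul]
    exact mul_le_mul (hM x) hx (norm_nonneg _) ((norm_nonneg _).trans (hM x))
  have h1 := norm_integral_le_of_norm_le_const this
  rwa [probReal_univ, mul_one] at h1

/-- The unimodular function with `unitConj z * z = ‖z‖`. -/
def unitConj (z : ℂ) : ℂ := starRingEnd ℂ z / ‖z‖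

lemma measurable_unitConj : Measurable unitConj := by
  unfold unitConj
  exact Complex.continuous_conj.measurable.div
    (Complex.measurable_ofReal.comp measurable_norm)

lemma norm_unitConj_le (z : ℂ) : ‖unitConj z‖ ≤ 1 := by
  simpa [unitConj] using div_self_le_one ‖z‖

lemma unitConj_mul_self (z : ℂ) : unitConj z * z = ‖z‖ := by
  rcases eq_or_ne z 0 with rfl | hz
  · simp [unitConj]
  · rw [unitConj, div_mul_eq_mul_div, ← Complex.normSq_eq_conj_mul_self,
      Complex.normSq_eq_norm_sq]
    have : (‖z‖ : ℂ) ≠ 0 := by simpa using hz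
    push_cast
    field_simp

end LInfty

/-! ### Operators permuting the fibres -/

section PermutedFibres

variable {V E : Type*} [NormedAddCommGroup E] [NormedSpace ℂ E]

lemma exists_lpPermuted (A : E →L[ℂ] E) (σ : Equiv.Perm V) :
    ∃ L : lp (fun _ : V => E) 2 →L[ℂ] lp (fun _ : V => E) 2,
      ‖L‖ ≤ ‖A‖ ∧ ∀ g v, L g v = A (g (σ.symm v)) := by
  have h2 : 0 < (2 : ℝ≥0∞).toReal := by simp
  have hle (g : lp (fun _ : V => E) 2) (v : V) :
      ‖A (g (σ.symm v))‖ ^ (2 : ℝ≥0∞).toReal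
        ≤ ‖A‖ ^ (2 : ℝ≥0∞).toReal * ‖g (σ.symm v)‖ ^ (2 : ℝ≥0∞).toReal := by
    rw [← Real.mul_rpow (norm_nonneg _) (norm_nonneg _)]
    exact Real.rpow_le_rpow (norm_nonneg _) (A.le_opNorm _) h2.le
  have hsum (g : lp (fun _ : V => E) 2) : HasSum (fun v => ‖A‖ ^ (2 : ℝ≥0∞).toReal *
      ‖g (σ.symm v)‖ ^ (2 : ℝ≥0∞).toReal) (‖A‖ ^ (2 : ℝ≥0∞).toReal * ‖g‖ ^ (2 : ℝ≥0∞).toReal) :=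
    ((σ.symm.hasSum_iff (f := fun v => ‖g v‖ ^ (2 : ℝ≥0∞).toReal)).2
      (lp.hasSum_norm h2 g)).mul_left _
  have hmem (g : lp (fun _ : V => E) 2) : Memℓp (fun v => A (g (σ.symm v))) 2 :=
    memℓp_gen (Summable.of_nonneg_of_le (fun v => by positivity) (hle g) (hsum g).summable)
  let L : lp (fun _ : V => E) 2 →ₗ[ℂ] lp (fun _ : V => E) 2 :=
    { toFun := fun g => ⟨_, hmem g⟩
      map_add' := fun g k => by ext1; funext v; exact map_add A _ _
      map_smul' := fun a g => by ext1; funext v; exact map_smul A a _ }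
  have hn (g : lp (fun _ : V => E) 2) : ‖L g‖ ≤ ‖A‖ * ‖g‖ := by
    refine lp.norm_le_of_forall_sum_le h2 (by positivity) fun s => ?_
    rw [Real.mul_rpow (norm_nonneg _) (norm_nonneg _)]
    exact (Finset.sum_le_sum fun v _ => hle g v).trans
      (sum_le_hasSum s (fun v _ => by positivity) (hsum g))
  exact ⟨L.mkContinuous _ hn, L.mkContinuous_norm_le (norm_nonneg _) hn, fun g v => rfl⟩

end PermutedFibres

/-! ### The transfer operator of one inverse branch -/

section InverseBranch

variable {X ι : Type*} [MeasurableSpace X] {θ : X → X} {μ : Measure X} {α : ι → Set X}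

lemma setIntegral_cell_comp [IsProbabilityMeasure μ] (hθ : IsFullGibbsMarkovMap θ μ α) (i : ι)
    {E : Type*} [NormedAddCommGroup E] [NormedSpace ℝ E] {u : X → E}
    (hu : AEStronglyMeasurable u μ) :
    ∫ x in α i, u (θ x) ∂μ = ∫ x, (branchJacobian θ μ α [i] x).toReal • u x ∂μ := by
  have hac : (μ.restrict (α i)).map θ ≪ μ := Measure.AbsolutelyContinuous.mk fun B hB h => by
    rw [Measure.map_apply hθ.measurable_map hB,
      Measure.restrict_apply (hθ.measurable_map hB), Set.inter_comm,
      hθ.measure_cell_inter_preimage_eq_zero_iff i hB]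
    exact h
  have e : branchJacobian θ μ α [i] = ((μ.restrict (α i)).map θ).rnDeriv μ := by
    simp [branchJacobian, cylinder]
  rw [e, integral_rnDeriv_smul hac, integral_map hθ.measurable_map.aemeasurable (hu.mono_ac hac)]

/-- The inverse branch `τ_i : θ (α i) → α i` of `θ`, extended to `X` by a constant. -/
def inverseBranch [Nonempty X] (θ : X → X) (α : ι → Set X) (i : ι) : X → X :=
  Function.invFunOn θ (α i)

variable [Nonempty X]

lemma inverseBranch_apply (hθ : IsMarkovMap θ μ α) (i : ι) {x : X} (hx : x ∈ α i) :
    inverseBranch θ α i (θ x) = x :=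
  (hθ.injOn i).leftInvOn_invFunOn hx

/-- Used for measurability. The second piece arises from the constant value off the image of the
cell; it is null by fullness. -/
lemma preimage_inverseBranch (hθ : IsMarkovMap θ μ α) (i : ι) (B : Set X) :
    inverseBranch θ α i ⁻¹' B =
      θ '' (α i ∩ B) ∪ ((θ '' α i)ᶜ ∩ {_x | Classical.choice ‹Nonempty X› ∈ B}) := by
  ext x
  by_cases hx : x ∈ θ '' α i
  · obtain ⟨y, hy, rfl⟩ := hx
    have h1 : θ y ∈ θ '' α i := ⟨y, hy, rfl⟩
    simp only [Set.mem_preimage, inverseBranch_apply hθ i hy, Set.mem_union, Set.mem_inter_iff,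
      Set.mem_compl_iff, h1, not_true_eq_false, false_and, or_false]
    refine ⟨fun h => ⟨y, ⟨hy, h⟩, rfl⟩, ?_⟩
    rintro ⟨z, ⟨hz, hzB⟩, hzy⟩
    rwa [← hθ.injOn i hz hy hzy]
  · have h1 : x ∉ θ '' (α i ∩ B) := fun h => hx (Set.image_mono Set.inter_subset_left h)
    have h2 : inverseBranch θ α i x = Classical.choice ‹Nonempty X› :=
      Function.invFunOn_neg (by simpa using hx)
    simp [h1, h2, hx]

lemma quasiMeasurePreserving_inverseBranch (hθ : IsFullGibbsMarkovMap θ μ α) (i : ι) :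
    Measure.QuasiMeasurePreserving (inverseBranch θ α i) μ μ := by
  have hm : Measurable (inverseBranch θ α i) := fun B hB => by
    rw [preimage_inverseBranch hθ.toIsMarkovMap]
    refine (hθ.measurable_image i _ Set.inter_subset_left ((hθ.measurable_cell i).inter hB)).union
      ((hθ.measurable_image i _ subset_rfl (hθ.measurable_cell i)).compl.inter ?_)
    exact MeasurableSet.const _
  refine ⟨hm, Measure.AbsolutelyContinuous.mk fun B hB h => ?_⟩
  rw [Measure.map_apply hm hB, preimage_inverseBranch hθ.toIsMarkovMap]
  refine measure_union_null ?_ (measure_mono_null Set.inter_subset_left (hθ.full i))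
  rw [hθ.nonsingular i _ Set.inter_subset_left ((hθ.measurable_cell i).inter hB)]
  exact measure_mono_null Set.inter_subset_right h

/-- The operator is h ↦ φ_i · (h ∘ τ_i), and both identities are changes of variables. The L¹
identity later supplies the absolute convergence for exchanging sums. -/
lemma exists_branchTransfer [IsProbabilityMeasure μ] (hθ : IsFullGibbsMarkovMap θ μ α) (i : ι)
    {c : ℝ≥0∞} (hc : c ≠ ∞) (hJ : ∀ᵐ x ∂μ, branchJacobian θ μ α [i] x ≤ c) :
    ∃ A : Lp ℂ ∞ μ →L[ℂ] Lp ℂ ∞ μ, ‖A‖ ≤ c.toReal ∧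
      (∀ h : Lp ℂ ∞ μ, ∫ x, ‖A h x‖ ∂μ = ∫ x in α i, ‖h x‖ ∂μ) ∧
      ∀ (h : Lp ℂ ∞ μ) (f : X → ℂ), Measurable f →
        ∫ x, f x * A h x ∂μ = ∫ x in α i, f (θ x) * h x ∂μ := by
  have hτ := quasiMeasurePreserving_inverseBranch hθ i
  obtain ⟨A, hA, hA'⟩ := exists_weightedComposition hτ
    (IsFullGibbsMarkovMap.measurable_branchJacobian θ μ α [i]).ennreal_toReal
    ENNReal.toReal_nonneg (hJ.mono fun x hx => by
      rw [abs_of_nonneg ENNReal.toReal_nonneg]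
      exact ENNReal.toReal_mono hc hx)
  have hmeas (h : Lp ℂ ∞ μ) : AEStronglyMeasurable (fun x => h (inverseBranch θ α i x)) μ :=
    (Lp.aestronglyMeasurable h).comp_quasiMeasurePreserving hτ
  refine ⟨A, hA, fun h => ?_, fun h f hf => ?_⟩
  · calc ∫ x, ‖A h x‖ ∂μ
        = ∫ x, (branchJacobian θ μ α [i] x).toReal • ‖h (inverseBranch θ α i x)‖ ∂μ := by
          refine integral_congr_ae ?_
          filter_upwards [hA' h] with x hx
          simp [hx]
      _ = ∫ x in α i, ‖h (inverseBranch θ α i (θ x))‖ ∂μ :=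
          (setIntegral_cell_comp hθ i (hmeas h).norm).symm
      _ = _ := setIntegral_congr_fun (hθ.measurable_cell i) fun x hx => by
          simp only [inverseBranch_apply hθ.toIsMarkovMap i hx]
  · calc ∫ x, f x * A h x ∂μ
        = ∫ x, (branchJacobian θ μ α [i] x).toReal • (f x * h (inverseBranch θ α i x)) ∂μ := by
          refine integral_congr_ae ?_
          filter_upwards [hA' h] with x hx
          simp [hx, mul_left_comm]
      _ = ∫ x in α i, f (θ x) * h (inverseBranch θ α i (θ x)) ∂μ :=
          (setIntegral_cell_comp hθ i (hf.aestronglyMeasurable.mul (hmeas h))).symm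
      _ = _ := setIntegral_congr_fun (hθ.measurable_cell i) fun x hx => by
          simp only [inverseBranch_apply hθ.toIsMarkovMap i hx]

end InverseBranch

end

/-! ### Construction of the transfer operator -/

section

variable {X ι V : Type*} [MeasurableSpace X] {θ : X → X} {μ : Measure X} {α : ι → Set X}
  {G : Digraph V} {κ : X → Equiv.Perm V}

lemma IsFullGibbsMarkovMap.exists_cellCocycle (hθ : IsFullGibbsMarkovMap θ μ α)
    (hκ : IsNearestNeighbourCocycle α G κ) :
    ∃ σ : ι → Equiv.Perm V, ∀ i, ∀ x ∈ α i, κ x = σ i := by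
  choose p hp using fun i => nonempty_of_measure_ne_zero (hθ.cell_pos i).ne'
  exact ⟨fun i => κ (p i), fun i x hx => hκ.const i x hx (p i) (hp i)⟩

variable [Countable ι]

lemma tsum_measure_cell [IsProbabilityMeasure μ] (hθ : IsMarkovMap θ μ α) :
    ∑' i, μ (α i) = 1 := by
  rw [← measure_iUnion hθ.disjoint hθ.measurable_cell, hθ.cover, measure_univ]

variable [Countable V] [MeasurableSpace V]

lemma measurable_iterCocycle_apply (hθ : IsMarkovMap θ μ α)
    (hκ : IsNearestNeighbourCocycle α G κ) (n : ℕ) (v : V) :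
    Measurable fun x => iterCocycle θ κ n x v :=
  measurable_to_countable' fun w => measurableSet_iterCocycle_eq hθ hκ n v w

lemma measurable_extension [DiscreteMeasurableSpace V] (hθ : IsMarkovMap θ μ α) (hκ : IsNearestNeighbourCocycle α G κ) :
    Measurable (extension θ κ) :=
  (hθ.measurable_map.comp measurable_fst).prodMk
    (measurable_from_prod_countable_left fun v => by
      simpa [iterCocycle] using measurable_iterCocycle_apply hθ hκ 1 v)

variable [MeasurableSingletonClass V] [IsProbabilityMeasure μ]

lemma exists_isTransferOperator (hθ : IsFullGibbsMarkovMap θ μ α)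
    (hκ : IsNearestNeighbourCocycle α G κ) :
    ∃ L : HInfty V μ →L[ℂ] HInfty V μ, IsTransferOperator θ μ κ L := by
  have : Nonempty X := nonempty_of_isProbabilityMeasure μ
  obtain ⟨K, -, hK, hJ⟩ := hθ.exists_branchJacobian_bounds
  obtain ⟨σ, hσ⟩ := hθ.exists_cellCocycle hκ
  choose A hA hAnorm hAdual using fun i => exists_branchTransfer hθ i
    (ENNReal.mul_ne_top hK (measure_ne_top μ (cylinder θ α [i]))) ((hJ [i]).mono fun x hx => hx.1)
  choose Λ hΛ hΛapply using fun i => exists_lpPermuted (A i) (σ i)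
  have hsummable : Summable Λ := by
    refine Summable.of_norm_bounded (g := fun i => (K * μ (cylinder θ α [i])).toReal)
      (ENNReal.summable_toReal ?_) fun i => (hΛ i).trans (hA i)
    simp only [cylinder, Set.preimage_univ, Set.inter_univ]
    rw [ENNReal.tsum_mul_left, tsum_measure_cell hθ.toIsMarkovMap, mul_one]
    exact hK
  obtain ⟨L, hL⟩ := hsummable
  have hLapply (g : HInfty V μ) (v : V) : HasSum (fun i => A i (g ((σ i).symm v))) (L g v) := by
    have h1 := (ContinuousLinearMap.apply ℂ (HInfty V μ) g).hasSum hL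
    have h2 := (lp.evalCLM ℂ (fun _ : V => Lp ℂ ∞ μ) 2 v).hasSum h1
    refine h2.congr_fun fun i => ?_
    exact (hΛapply i g v).symm
  -- Both sides of the duality are iterated sums of one absolutely summable family over V × ι. They
  -- are stated fibrewise because integrability of `L g` is not yet available; it is deduced from
  -- this statement.
  have core : ∀ g : HInfty V μ, Integrable (HInfty.toFun g) (μ.prod Measure.count) →
      ∀ f : X × V → ℂ, Measurable f → (∃ M : ℝ, ∀ p, ‖f p‖ ≤ M) → ∃ S : ℂ,
        HasSum (fun u => ∫ x, f (x, u) * L g u x ∂μ) S ∧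
        HasSum (fun v => ∫ x, f (extension θ κ (x, v)) * g v x ∂μ) S := by
    intro g hg f hf ⟨M, hM⟩
    have hg' := (integrable_prod_count_iff.1 hg).2
    have hfu (u : V) : Measurable fun x => f (x, u) := hf.comp measurable_prodMk_right
    have hM0 (p : X × V) : 0 ≤ M := (norm_nonneg _).trans (hM p)
    -- For each cell, this passes from the target fibre to the source fibre.
    let e : V × ι ≃ V × ι :=
      { toFun := fun p => ((σ p.2).symm p.1, p.2)
        invFun := fun p => (σ p.2 p.1, p.2)
        left_inv := fun p => by simp
        right_inv := fun p => by simp }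
    have hN (v : V) : HasSum (fun i => ∫ x, ‖A i (g v) x‖ ∂μ) (∫ x, ‖g v x‖ ∂μ) := by
      have := hasSum_integral_iUnion (f := fun x => ‖g v x‖) hθ.measurable_cell hθ.disjoint
        (integrable_coeFn_lInfty (μ := μ) (g v)).norm.integrableOn
      rw [hθ.cover, setIntegral_univ] at this
      exact this.congr_fun fun i => hAnorm i (g v)
    have hNsum : Summable fun p : V × ι => ∫ x, ‖A p.2 (g p.1) x‖ ∂μ := by
      refine (summable_prod_of_nonneg fun p => integral_nonneg fun x => norm_nonneg _).2
        ⟨fun v => (hN v).summable, ?_⟩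
      refine hg'.congr fun v => ?_
      exact (hN v).tsum_eq.symm
    let a : V × ι → ℂ := fun p => ∫ x, f (x, p.1) * A p.2 (g ((σ p.2).symm p.1)) x ∂μ
    have ha : Summable a := by
      refine Summable.of_norm_bounded (((e.summable_iff).2 hNsum).mul_left M) fun p => ?_
      change ‖a p‖ ≤ M * ∫ x, ‖A p.2 (g ((σ p.2).symm p.1)) x‖ ∂μ
      rw [← integral_const_mul]
      refine norm_integral_le_of_norm_le
        ((integrable_coeFn_lInfty _).norm.const_mul M) (ae_of_all _ fun x => ?_)
      rw [norm_mul]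
      gcongr
      exact hM _
    obtain ⟨S, hS⟩ := ha
    refine ⟨S, hS.prod_fiberwise fun u => ?_, ?_⟩
    · obtain ⟨Φ, hΦ⟩ := exists_integralFunctional (μ := μ) (hfu u) (fun x => hM (x, u))
      have := Φ.hasSum (hLapply g u)
      simp_rw [hΦ] at this
      exact this
    · refine HasSum.prod_fiberwise (f := a ∘ e.symm) ((e.symm.hasSum_iff).2 hS) fun v => ?_
      have hint : Integrable (fun x => f (extension θ κ (x, v)) * g v x) μ :=
        (integrable_coeFn_lInfty _).bdd_mul ((hf.comp (measurable_extension hθ.toIsMarkovMap hκ)).comp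
          measurable_prodMk_right).aestronglyMeasurable (ae_of_all _ fun x => hM _)
      have := hasSum_integral_iUnion hθ.measurable_cell hθ.disjoint hint.integrableOn
      rw [hθ.cover, setIntegral_univ] at this
      refine this.congr_fun fun i => ?_
      have h1 : (a ∘ e.symm) (v, i) = ∫ x, f (x, σ i v) * A i (g v) x ∂μ := by
        simp [a, e]
      rw [h1, hAdual i (g v) _ (hfu (σ i v))]
      refine setIntegral_congr_fun (hθ.measurable_cell i) fun x hx => ?_
      simp only [extension, hσ i x hx]
  refine ⟨L, fun g hg => ?_⟩
  have hLg : Integrable (HInfty.toFun (L g)) (μ.prod Measure.count) := by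
    refine integrable_prod_count_iff.2 ⟨fun v => integrable_coeFn_lInfty (L g v), ?_⟩
    -- Testing against the conjugate phase of `L g` makes the fibre integrals equal to its fibre L¹
    -- norms, which are therefore summable.
    obtain ⟨S, hS, -⟩ := core g hg (fun p => unitConj (L g p.2 p.1))
      (measurable_from_prod_countable_left fun v =>
        measurable_unitConj.comp (Lp.stronglyMeasurable (L g v)).measurable)
      ⟨1, fun p => norm_unitConj_le _⟩
    simp_rw [unitConj_mul_self, integral_complex_ofReal] at hS
    exact Complex.summable_ofReal.1 hS.summable
  refine ⟨hLg, fun f hf hfM => ?_⟩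
  obtain ⟨S, hS, hS'⟩ := core g hg f hf hfM
  obtain ⟨M, hM⟩ := hfM
  have h1 := hasSum_integral_prod_count (hLg.bdd_mul hf.aestronglyMeasurable (ae_of_all _ hM))
  have h2 := hasSum_integral_prod_count (hg.bdd_mul
    (hf.comp (measurable_extension hθ.toIsMarkovMap hκ)).aestronglyMeasurable
    (ae_of_all _ fun p => hM _))
  exact (h2.unique hS').trans (h1.unique hS).symm

end

/-! ### Powers of the transfer operator and the kernel -/

section

section FibreNorms

variable {X V : Type*} [MeasurableSpace X] {μ : Measure X}

lemma enorm_sq_eq_tsum (g : HInfty V μ) : ‖g‖ₑ ^ 2 = ∑' v, ‖g v‖ₑ ^ 2 := by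
  have h := lp.hasSum_norm (p := 2) (by simp) g
  simp only [ENNReal.toReal_ofNat, Real.rpow_ofNat] at h
  have h1 := ENNReal.ofReal_tsum_of_nonneg (fun v => by positivity) h.summable
  rw [h.tsum_eq] at h1
  simpa only [ENNReal.ofReal_pow (norm_nonneg _), ofReal_norm] using h1

open Classical in
lemma toFun_single (v u : V) (h : Lp ℂ ∞ μ) :
    (fun x => HInfty.toFun (lp.single 2 v h : HInfty V μ) (x, u)) =ᵐ[μ]
      if u = v then h else 0 := by
  by_cases huv : u = v
  · subst huv
    rw [if_pos rfl]
    refine Eventually.of_forall fun x => ?_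
    simp only [HInfty.toFun, lp.single_apply_self]
  · rw [if_neg huv]
    have h0 : (lp.single 2 v h : HInfty V μ) u = 0 :=
      lp.single_apply_ne (E := fun _ : V => Lp ℂ ∞ μ) 2 v h huv
    filter_upwards [Lp.coeFn_zero ℂ ∞ μ] with x hx
    simp only [HInfty.toFun, h0]
    exact hx

open Classical in
lemma integrable_toFun_single [IsProbabilityMeasure μ] [Countable V] [MeasurableSpace V]
    [MeasurableSingletonClass V] (v : V) (h : Lp ℂ ∞ μ) :
    Integrable (HInfty.toFun (lp.single 2 v h : HInfty V μ)) (μ.prod Measure.count) := by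
  refine integrable_prod_count_iff.2 ⟨fun u => integrable_coeFn_lInfty ((lp.single 2 v h : HInfty V μ) u), ?_⟩
  refine summable_of_ne_finset_zero (s := {v}) fun u hu => ?_
  have huv : u ≠ v := by simpa using hu
  rw [integral_congr_ae (g := fun _ => (0 : ℝ)), integral_zero]
  filter_upwards [toFun_single v u h] with x hx
  rw [hx, if_neg huv]
  simp

end FibreNorms

variable {X ι V : Type*} [MeasurableSpace X] {θ : X → X} {μ : Measure X} {α : ι → Set X}
  {G : Digraph V} {κ : X → Equiv.Perm V} [MeasurableSpace V] {L : HInfty V μ →L[ℂ] HInfty V μ}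

lemma IsTransferOperator.pow [Countable ι] [Countable V] [MeasurableSingletonClass V]
    (hL : IsTransferOperator θ μ κ L) (hθ : IsMarkovMap θ μ α)
    (hκ : IsNearestNeighbourCocycle α G κ) (n : ℕ) (g : HInfty V μ)
    (hg : Integrable (HInfty.toFun g) (μ.prod Measure.count)) :
    Integrable (HInfty.toFun ((L ^ n) g)) (μ.prod Measure.count) ∧
    ∀ f : X × V → ℂ, Measurable f → (∃ M : ℝ, ∀ p, ‖f p‖ ≤ M) →
      ∫ p, f ((extension θ κ)^[n] p) * HInfty.toFun g p ∂(μ.prod Measure.count) =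
        ∫ p, f p * HInfty.toFun ((L ^ n) g) p ∂(μ.prod Measure.count) := by
  induction n with
  | zero => exact ⟨hg, fun f _ _ => rfl⟩
  | succ n ih =>
    have e : (L ^ (n + 1)) g = L ((L ^ n) g) := by rw [pow_succ']; rfl
    rw [e]
    refine ⟨(hL _ ih.1).1, fun f hf hM => ?_⟩
    rw [← (hL _ ih.1).2 f hf hM, ← ih.2 (fun p => f (extension θ κ p))
      (hf.comp (measurable_extension hθ hκ)) (hM.imp fun M h p => h _)]
    simp_rw [Function.iterate_succ_apply']

variable [Countable ι] [Countable V] [MeasurableSingletonClass V] [IsProbabilityMeasure μ]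

open Classical in
-- This is duality for Tⁿ with the test function φ ⊗ 1_w; it carries all the information about `L ^
-- n` that is used later.
lemma IsTransferOperator.integral_pow_single (hL : IsTransferOperator θ μ κ L)
    (hθ : IsMarkovMap θ μ α) (hκ : IsNearestNeighbourCocycle α G κ) (n : ℕ) (v w : V)
    (h : Lp ℂ ∞ μ) {φ : X → ℂ} (hφ : Measurable φ) {M : ℝ} (hM : ∀ x, ‖φ x‖ ≤ M) :
    ∫ x, φ x * (L ^ n) (lp.single 2 v h) w x ∂μ =
      ∫ x in {x | iterCocycle θ κ n x v = w}, φ (θ^[n] x) * h x ∂μ := by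
  obtain ⟨hint, hdual⟩ := hL.pow hθ hκ n _ (integrable_toFun_single v h)
  set f : X × V → ℂ := fun p => if p.2 = w then φ p.1 else 0 with hf
  have hfm : Measurable f := measurable_from_prod_countable_left fun u => by
    by_cases hu : u = w
    · simpa [hf, hu] using hφ
    · simp [hf, hu]
  have hfM (p : X × V) : ‖f p‖ ≤ M := by
    by_cases hp : p.2 = w
    · simpa [hf, hp] using hM p.1
    · simpa [hf, hp] using (norm_nonneg _).trans (hM p.1)
  have hTm : Measurable fun p => f ((extension θ κ)^[n] p) :=
    hfm.comp ((measurable_extension hθ hκ).iterate n)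
  have h1 := hasSum_integral_prod_count
    (hint.bdd_mul hfm.aestronglyMeasurable (ae_of_all _ hfM))
  have h2 := hasSum_integral_prod_count
    ((integrable_toFun_single v h).bdd_mul hTm.aestronglyMeasurable (ae_of_all _ fun p => hfM _))
  have e1 := h1.unique (hasSum_single w fun u hu => by simp [hf, hu])
  have e2 := h2.unique (hasSum_single v fun u hu => by
    rw [integral_congr_ae (g := fun _ => (0 : ℂ)), integral_zero]
    filter_upwards [toFun_single v u h] with x hx
    rw [hx, if_neg hu]
    simp)
  have e3 := e1.symm.trans ((hdual f hfm ⟨M, hfM⟩).symm.trans e2)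
  have e4 : ∫ x, f (x, w) * HInfty.toFun ((L ^ n) (lp.single 2 v h)) (x, w) ∂μ =
      ∫ x, φ x * (L ^ n) (lp.single 2 v h) w x ∂μ := by
    simp only [hf, if_true]
    rfl
  rw [← e4, e3, ← integral_indicator (measurableSet_iterCocycle_eq hθ hκ n v w)]
  refine integral_congr_ae ?_
  filter_upwards [toFun_single v v h] with x hx
  rw [hx, if_pos rfl, extension_iterate]
  by_cases hx : iterCocycle θ κ n x v = w
  · simp [hf, hx]
  · simp [hf, hx]

open Classical in
-- Testing against the conjugate phase restricted to an arbitrary set B bounds ∫_B ‖k‖ by ‖h‖ times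
-- the measure of a cocycle event intersected with θ⁻ⁿB. Quasi-independence bounds this by a
-- multiple of μ(B), which gives a pointwise bound almost everywhere.
lemma IsTransferOperator.enorm_pow_single_le (hL : IsTransferOperator θ μ κ L) {K : ℝ≥0∞}
    (hK : QuasiIndependent θ μ κ K)
    (hθ : IsMarkovMap θ μ α) (hκ : IsNearestNeighbourCocycle α G κ) (n : ℕ) (v w : V)
    (h : Lp ℂ ∞ μ) :
    ‖(L ^ n) (lp.single 2 v h) w‖ₑ ≤ K * (transition θ μ κ n v w * ‖h‖ₑ) := by
  set k : Lp ℂ ∞ μ := (L ^ n) (lp.single 2 v h) w with hk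
  have hkm : Measurable k := (Lp.stronglyMeasurable k).measurable
  have hE := measurableSet_iterCocycle_eq hθ hκ n v w
  have key : ∀ᵐ x ∂μ, ‖k x‖ₑ ≤ K * (transition θ μ κ n v w * ‖h‖ₑ) := by
    refine ae_le_of_forall_setLIntegral_le_of_sigmaFinite hkm.enorm fun B hB _ => ?_
    have hφm : Measurable (B.indicator fun x => unitConj (k x)) :=
      (measurable_unitConj.comp hkm).indicator hB
    have hφ1 (x : X) : ‖B.indicator (fun x => unitConj (k x)) x‖ ≤ 1 :=
      (norm_indicator_le_norm_self _ _).trans (norm_unitConj_le _)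
    have h1 := hL.integral_pow_single hθ hκ n v w h hφm hφ1
    rw [← hk] at h1
    have h2 : ∫ x, B.indicator (fun x => unitConj (k x)) x * k x ∂μ =
        ((∫ x in B, ‖k x‖ ∂μ : ℝ) : ℂ) := by
      rw [← integral_complex_ofReal, ← integral_indicator hB]
      refine integral_congr_ae (Eventually.of_forall fun x => ?_)
      by_cases hx : x ∈ B
      · simp [hx, unitConj_mul_self]
      · simp [hx]
    have h3 : ∫ x in {x | iterCocycle θ κ n x v = w},
          B.indicator (fun x => unitConj (k x)) (θ^[n] x) * h x ∂μ =
        ∫ x in {x | iterCocycle θ κ n x v = w} ∩ θ^[n] ⁻¹' B, unitConj (k (θ^[n] x)) * h x ∂μ := by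
      rw [← setIntegral_indicator (hθ.measurable_iterate n hB)]
      refine integral_congr_ae (Eventually.of_forall fun x => ?_)
      by_cases hx : θ^[n] x ∈ B
      · simp [hx]
      · simp [hx]
    have h4 : ‖∫ x in {x | iterCocycle θ κ n x v = w} ∩ θ^[n] ⁻¹' B,
        unitConj (k (θ^[n] x)) * h x ∂μ‖ ≤
        ‖h‖ * μ.real ({x | iterCocycle θ κ n x v = w} ∩ θ^[n] ⁻¹' B) := by
      refine norm_setIntegral_le_of_norm_le_const_ae (measure_lt_top _ _)
        (ae_restrict_of_ae ?_)
      filter_upwards [ae_norm_le_norm h] with x hx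
      rw [norm_mul]
      exact (mul_le_of_le_one_left (norm_nonneg _) (norm_unitConj_le _)).trans hx
    rw [← h3, ← h1, h2, Complex.norm_real,
      Real.norm_of_nonneg (integral_nonneg fun x => norm_nonneg _)] at h4
    have h5 := ENNReal.ofReal_le_ofReal h4
    rw [ofReal_integral_norm_eq_lintegral_enorm (integrable_coeFn_lInfty k).integrableOn,
      ENNReal.ofReal_mul (norm_nonneg _), ofReal_norm, ofReal_measureReal] at h5
    refine h5.trans ?_
    rw [setLIntegral_const]
    calc _ ≤ ‖h‖ₑ * (K * (transition θ μ κ n v w * μ B)) :=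
          mul_le_mul_right (hK n v w B hB).1 _
      _ = _ := by ring
  rw [Lp.enorm_def, eLpNorm_exponent_top]
  exact eLpNormEssSup_le_of_ae_enorm_bound key

lemma IsTransferOperator.enorm_pow_apply_le (hL : IsTransferOperator θ μ κ L) {K : ℝ≥0∞}
    (hK : QuasiIndependent θ μ κ K)
    (hθ : IsMarkovMap θ μ α) (hκ : IsNearestNeighbourCocycle α G κ) (n : ℕ)
    (g : HInfty V μ) (w : V) :
    ‖(L ^ n) g w‖ₑ ≤ K * ∑' v, transition θ μ κ n v w * ‖g v‖ₑ := by
  classical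
  have h1 := (lp.evalCLM ℂ (fun _ : V => Lp ℂ ∞ μ) 2 w).hasSum
    ((L ^ n).hasSum (lp.hasSum_single ENNReal.ofNat_ne_top g))
  have h2 : (L ^ n) g w = ∑' v, (L ^ n) (lp.single 2 v (g v)) w := h1.tsum_eq.symm
  rw [h2, ← ENNReal.tsum_mul_left]
  exact enorm_tsum_le_tsum_enorm.trans
    (ENNReal.tsum_le_tsum fun v => hL.enorm_pow_single_le hK hθ hκ n v w (g v))

/-- The hypothesis has `m ^ 2` because the Schur test concerns P_n P_nᵀ, whose norm is the square of
that of P_n. -/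
lemma IsTransferOperator.enorm_pow_le (hL : IsTransferOperator θ μ κ L) {K : ℝ≥0∞}
    (hK : QuasiIndependent θ μ κ K)
    (hθ : IsMarkovMap θ μ α) (hκ : IsNearestNeighbourCocycle α G κ) (n : ℕ)
    {h : V → ℝ≥0∞} (h0 : ∀ v, h v ≠ 0) (h1 : ∀ v, h v ≠ ∞) {m : ℝ≥0∞}
    (hm : ∀ v, ∑' v', (∑' w, transition θ μ κ n v w * transition θ μ κ n v' w) * h v'
      ≤ m ^ 2 * h v) :
    ‖L ^ n‖ₑ ≤ K * m := by
  have key (g : HInfty V μ) : ‖(L ^ n) g‖ₑ ≤ K * m * ‖g‖ₑ := by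
    rw [← ENNReal.pow_le_pow_left_iff two_ne_zero, enorm_sq_eq_tsum]
    calc ∑' w, ‖(L ^ n) g w‖ₑ ^ 2
        ≤ ∑' w, (K * ∑' v, transition θ μ κ n v w * ‖g v‖ₑ) ^ 2 :=
          ENNReal.tsum_le_tsum fun w => by
            gcongr
            exact hL.enorm_pow_apply_le hK hθ hκ n g w
      _ = K ^ 2 * ∑' w, (∑' v, transition θ μ κ n v w * ‖g v‖ₑ) ^ 2 := by
          simp_rw [mul_pow]
          rw [ENNReal.tsum_mul_left]
      _ ≤ K ^ 2 * (m ^ 2 * ∑' v, ‖g v‖ₑ ^ 2) :=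
          mul_le_mul_right (tsum_sq_le_of_schur h0 h1 hm _) _
      _ = _ := by rw [← enorm_sq_eq_tsum]; ring
  rcases eq_or_ne (K * m) ∞ with h | h
  · rw [h]; exact le_top
  lift K * m to NNReal using h with c
  exact (L ^ n).opENorm_le_bound key

/-- A transfer operator is unique. -/
lemma IsTransferOperator.unique {L' : HInfty V μ →L[ℂ] HInfty V μ}
    (hL : IsTransferOperator θ μ κ L) (hL' : IsTransferOperator θ μ κ L')
    (hθ : IsMarkovMap θ μ α) (hκ : IsNearestNeighbourCocycle α G κ) : L = L' := by
  classical
  have key (v : V) (h : Lp ℂ ∞ μ) : L (lp.single 2 v h) = L' (lp.single 2 v h) := by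
    ext1
    funext w
    set a := L (lp.single 2 v h) w
    set b := L' (lp.single 2 v h) w
    -- Testing both operators with the conjugate phase of a − b forces the L¹ norm of a − b to
    -- vanish.
    have hm : Measurable fun x => unitConj ((a - b : Lp ℂ ∞ μ) x) :=
      measurable_unitConj.comp (Lp.stronglyMeasurable _).measurable
    obtain ⟨Φ, hΦ⟩ := exists_integralFunctional (μ := μ) hm fun x => norm_unitConj_le _
    have e1 := hL.integral_pow_single hθ hκ 1 v w h hm fun x => norm_unitConj_le _
    have e2 := hL'.integral_pow_single hθ hκ 1 v w h hm fun x => norm_unitConj_le _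
    rw [pow_one] at e1 e2
    have e3 : Φ a = Φ b := by rw [hΦ, hΦ]; exact e1.trans e2.symm
    have e4 : Φ (a - b) = 0 := by rw [map_sub, e3, sub_self]
    simp_rw [hΦ, unitConj_mul_self] at e4
    rw [integral_complex_ofReal, Complex.ofReal_eq_zero,
      integral_eq_zero_iff_of_nonneg (fun x => norm_nonneg _)
        (integrable_coeFn_lInfty (a - b)).norm] at e4
    rw [← sub_eq_zero, Lp.eq_zero_iff_ae_eq_zero]
    filter_upwards [e4] with x hx
    simpa using hx
  ext1 g
  have h1 := L.hasSum (lp.hasSum_single ENNReal.ofNat_ne_top g)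
  have h2 := L'.hasSum (lp.hasSum_single ENNReal.ofNat_ne_top g)
  simp_rw [key] at h1
  exact h1.unique h2

/-- The return probability is bounded by the norm of the power of the transfer operator. -/
lemma IsTransferOperator.transition_le_enorm_pow (hL : IsTransferOperator θ μ κ L)
    (hθ : IsMarkovMap θ μ α) (hκ : IsNearestNeighbourCocycle α G κ) (n : ℕ) (o : V) :
    transition θ μ κ n o o ≤ ‖L ^ n‖ₑ := by
  classical
  set h : Lp ℂ ∞ μ := (memLp_top_const (1 : ℂ)).toLp _
  have hh : h =ᵐ[μ] fun _ => (1 : ℂ) := MemLp.coeFn_toLp _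
  have hnorm : ‖h‖ ≤ 1 := by
    rw [Lp.norm_def, eLpNorm_congr_ae hh, eLpNorm_exponent_top]
    refine ENNReal.toReal_le_of_le_ofReal zero_le_one (eLpNormEssSup_le_of_ae_bound ?_)
    simp
  have e := hL.integral_pow_single hθ hκ n o o h (measurable_const (a := (1 : ℂ)))
    (M := 1) (by simp)
  simp only [one_mul] at e
  rw [setIntegral_congr_ae (g := fun _ => (1 : ℂ)) (measurableSet_iterCocycle_eq hθ hκ n o o)
    (hh.mono fun x hx _ => hx), setIntegral_const] at e
  have h1 : μ.real {x | iterCocycle θ κ n x o = o} ≤ ‖L ^ n‖ := by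
    calc μ.real {x | iterCocycle θ κ n x o = o}
        = ‖∫ x, (L ^ n) (lp.single 2 o h) o x ∂μ‖ := by
          rw [e, norm_smul, norm_one, mul_one, Real.norm_of_nonneg measureReal_nonneg]
      _ ≤ ‖(L ^ n) (lp.single 2 o h) o‖ := by
          have := norm_integral_le_of_norm_le_const (ae_norm_le_norm ((L ^ n) (lp.single 2 o h) o))
          simpa using this
      _ ≤ ‖(L ^ n) (lp.single 2 o h)‖ := lp.norm_apply_le_norm (by simp) _ _
      _ ≤ ‖L ^ n‖ * ‖(lp.single 2 o h : HInfty V μ)‖ := (L ^ n).le_opNorm _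
      _ ≤ ‖L ^ n‖ := by
          rw [lp.norm_single (by simp)]
          exact mul_le_of_le_one_right (norm_nonneg _) hnorm
  have h2 := ENNReal.ofReal_le_ofReal h1
  rwa [ofReal_measureReal, ofReal_norm] at h2

/-! ### Bounds for the spectral radius -/

lemma spectralRadius_eq_limsup {A : Type*} [NormedRing A] [NormedAlgebra ℂ A] [CompleteSpace A]
    (a : A) : spectralRadius ℂ a = limsup (fun n : ℕ => ‖a ^ n‖ₑ ^ (1 / (n : ℝ))) atTop :=
  (spectrum.pow_nnnorm_pow_one_div_tendsto_nhds_spectralRadius a).limsup_eq.symm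

lemma IsTransferOperator.returnRate_le_spectralRadius (hL : IsTransferOperator θ μ κ L)
    (hθ : IsMarkovMap θ μ α) (hκ : IsNearestNeighbourCocycle α G κ) (o : V) :
    returnRate θ μ κ o ≤ spectralRadius ℂ L := by
  rw [spectralRadius_eq_limsup, returnRate_eq]
  exact limsup_le_limsup (Eventually.of_forall fun n =>
    ENNReal.rpow_le_rpow (hL.transition_le_enorm_pow hθ hκ n o) (by positivity))

lemma IsTransferOperator.spectralRadius_le_one (hL : IsTransferOperator θ μ κ L) {K : ℝ≥0∞}
    (hK : QuasiIndependent θ μ κ K) (hK' : K ≠ ∞)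
    (hθ : IsMarkovMap θ μ α) (hκ : IsNearestNeighbourCocycle α G κ) :
    spectralRadius ℂ L ≤ 1 := by
  rw [spectralRadius_eq_limsup]
  refine limsup_rpow_one_div_le hK' (Eventually.of_forall fun n => ?_)
  rw [one_pow]
  refine hL.enorm_pow_le hK hθ hκ n (h := 1) (by simp) (by simp) fun v => ?_
  simpa using (tsum_tsum_transition_mul_transition hθ hκ n v).le

/-! ### The symmetric case -/

section Symmetric

/-- Each of the three losses C_n, 2N_n + 1 and s^(-N_n) is subexponential, hence eventually at most
qⁿ. -/
lemma eventually_symmetry_factor_le {C : ℕ → ℝ} {N : ℕ → ℕ} (hC0 : ∀ n, 0 < C n)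
    (hC : Tendsto (fun n : ℕ => C n ^ (1 / (n : ℝ))) atTop (𝓝 1))
    (hN : Tendsto (fun n : ℕ => (N n : ℝ) / n) atTop (𝓝 0)) {s q : ℝ} (hs : 0 < s) (hs1 : s < 1)
    (hq : 1 < q) :
    ∀ᶠ n in atTop, C n * (2 * N n + 1) * s ^ (n + (n - N n)) ≤ ((q ^ 2 * s) ^ n) ^ 2 := by
  have hlogs : 0 < -Real.log s := by linarith [Real.log_neg hs hs1]
  have hlogq : 0 < Real.log q := Real.log_pos hq
  have e1 := hC.eventually_lt_const hq
  have e2 := hN.eventually_lt_const (div_pos hlogq hlogs)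
  have e3 := hN.eventually_lt_const one_pos
  have e4 : ∀ᶠ n : ℕ in atTop, 2 * (n : ℝ) + 1 ≤ q ^ n := by
    have := (tendsto_pow_const_div_const_pow_of_one_lt 1 hq).eventually_lt_const
      (show (0 : ℝ) < 1 / 3 by norm_num)
    filter_upwards [this, eventually_gt_atTop 0] with n hn hn0
    rw [pow_one, div_lt_iff₀ (by positivity)] at hn
    have : (1 : ℝ) ≤ n := by exact_mod_cast hn0
    linarith
  filter_upwards [e1, e2, e3, e4, eventually_gt_atTop 0] with n h1 h2 h3 h4 hn
  have hn' : (0 : ℝ) < n := by exact_mod_cast hn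
  have hq0 : 0 < q := by linarith
  have hNn : (N n : ℝ) ≤ n := by
    rw [div_lt_one hn'] at h3
    exact h3.le
  have hNn' : N n ≤ n := by exact_mod_cast hNn
  have c1 : C n ≤ q ^ n := by
    have h5 := pow_le_pow_left₀ (Real.rpow_nonneg (hC0 n).le _) h1.le n
    rwa [← Real.rpow_natCast (C n ^ _), ← Real.rpow_mul (hC0 n).le,
      one_div_mul_cancel hn'.ne', Real.rpow_one] at h5
  have c2 : 2 * (N n : ℝ) + 1 ≤ q ^ n := by linarith
  have c3 : s ^ (n - N n) ≤ q ^ n * s ^ n := by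
    rw [← Real.log_le_log_iff (by positivity) (by positivity),
      Real.log_mul (by positivity) (by positivity), Real.log_pow, Real.log_pow, Real.log_pow,
      Nat.cast_sub hNn']
    rw [div_lt_div_iff₀ hn' hlogs] at h2
    linarith
  have hs0 := hs.le
  calc C n * (2 * N n + 1) * s ^ (n + (n - N n))
      ≤ q ^ n * q ^ n * (s ^ n * (q ^ n * s ^ n)) := by
        rw [pow_add]
        gcongr
    -- A fourth, superfluous factor qⁿ makes the bound a perfect square, as the Schur estimate
    -- requires.
    _ ≤ q ^ n * q ^ n * (s ^ n * (q ^ n * s ^ n)) * q ^ n :=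
        le_mul_of_one_le_right (by positivity) (one_le_pow₀ hq.le)
    _ = _ := by ring

lemma IsTransferOperator.spectralRadius_le_returnRate (hL : IsTransferOperator θ μ κ L)
    {K : ℝ≥0∞} (hK : QuasiIndependent θ μ κ K) (hK' : K ≠ ∞) (hθ : IsFullGibbsMarkovMap θ μ α)
    (hκ : IsNearestNeighbourCocycle α G κ) (hT : IsTransitiveExtension θ μ α κ)
    (hsymm : IsSymmetricExtension θ μ κ) (o : V) :
    spectralRadius ℂ L ≤ returnRate θ μ κ o := by
  refine le_of_forall_gt_imp_ge_of_dense fun t' ht' => ?_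
  -- The Green function estimate needs a parameter at most 1; larger `t'` are covered by ρ ≤ 1.
  rcases le_or_gt 1 t' with h1 | ht1
  · exact (hL.spectralRadius_le_one hK hK' hθ.toIsMarkovMap hκ).trans h1
  obtain ⟨s', hs1, hs2⟩ := exists_between ht'
  lift t' to NNReal using ht1.ne_top
  lift s' to NNReal using hs2.ne_top
  have hs0 : (s' : ℝ≥0∞) ≠ 0 := ((zero_le).trans_lt hs1).ne'
  have hs0' : (0 : ℝ) < s' := by
    have : s' ≠ 0 := by exact_mod_cast hs0
    positivity
  have hst : (s' : ℝ) < t' := by exact_mod_cast hs2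
  have ht1' : (t' : ℝ) < 1 := by exact_mod_cast ht1
  -- Chosen so that q² s' = t': the gap between s' and t' absorbs the subexponential losses.
  set q := Real.sqrt (t' / s') with hq
  have hq1 : 1 < q := by
    rw [hq, Real.lt_sqrt zero_le_one, one_pow, one_lt_div hs0']
    exact hst
  have hqs : q ^ 2 * s' = t' := by
    rw [hq, Real.sq_sqrt (by positivity), div_mul_cancel₀ _ hs0'.ne']
  obtain ⟨C, N, hC0, hC, hN, hCN⟩ := hsymm
  have hev := eventually_symmetry_factor_le hC0 hC hN hs0' (hst.trans ht1') hq1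
  rw [hqs] at hev
  rw [spectralRadius_eq_limsup]
  refine limsup_rpow_one_div_le (D := K * K) (ENNReal.mul_ne_top hK' hK') ?_
  filter_upwards [hev, eventually_gt_atTop 0] with n hn hn0
  rw [mul_assoc]
  refine hL.enorm_pow_le hK hθ.toIsMarkovMap hκ n (h := green θ μ κ s' o)
    (fun v => green_ne_zero hθ hκ hT hs2.ne_top o v)
    (fun v => green_ne_top hK hK' hθ hκ hT o v hs1) fun v => ?_
  have hCN' (v w : V) : transition θ μ κ n v w ≤ ENNReal.ofReal (C n) *
      ∑ k ∈ Finset.Icc (n - N n) (n + N n), transition θ μ κ k w v := by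
    have h1 := ENNReal.ofReal_le_ofReal (hCN n hn0 v w)
    rw [ofReal_measureReal, ENNReal.ofReal_mul (hC0 n).le,
      ENNReal.ofReal_sum_of_nonneg fun k _ => measureReal_nonneg] at h1
    rwa [Finset.sum_congr rfl fun k _ => ofReal_measureReal] at h1
  refine (tsum_green_le_of_symmetric hK hθ hκ hs0 (hs2.trans ht1).le hCN' o v).trans ?_
  refine mul_le_mul_left ?_ _
  have h2 := ENNReal.ofReal_le_ofReal hn
  rw [ENNReal.ofReal_mul (by have := hC0 n; positivity), ENNReal.ofReal_mul (hC0 n).le,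
    ENNReal.ofReal_pow (by positivity), ENNReal.ofReal_pow (by positivity),
    ENNReal.ofReal_pow (by positivity), ENNReal.ofReal_coe_nnreal, ENNReal.ofReal_coe_nnreal,
    ENNReal.ofReal_add (by positivity) zero_le_one, ENNReal.ofReal_mul zero_le_two,
    ENNReal.ofReal_natCast, ENNReal.ofReal_one, ENNReal.ofReal_ofNat] at h2
  calc _ = K ^ 2 * (ENNReal.ofReal (C n) * (2 * N n + 1) * (s' : ℝ≥0∞) ^ (n + (n - N n))) := by
        ring
    _ ≤ K ^ 2 * ((t' : ℝ≥0∞) ^ n) ^ 2 := mul_le_mul_right h2 _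
    _ = _ := by ring

end Symmetric

end

end GraphExtension

end


theorem mainTheorem7 {X ι V : Type*} [MeasurableSpace X] [StandardBorelSpace X] [Countable ι]
    [Countable V] [MeasurableSpace V] [MeasurableSingletonClass V]
    (θ : X → X) (μ : MeasureTheory.Measure X) [MeasureTheory.IsProbabilityMeasure μ]
    (α : ι → Set X) (hθ : GraphExtension.IsFullGibbsMarkovMap θ μ α)
    (G : Digraph V) (κ : X → Equiv.Perm V)
    (hκ : GraphExtension.IsNearestNeighbourCocycle α G κ)
    (hT : GraphExtension.IsTransitiveExtension θ μ α κ) :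
    -- the transfer operator is a well-defined bounded operator on `𝓗_∞`
    (∃! L : GraphExtension.HInfty V μ →L[ℂ] GraphExtension.HInfty V μ,
      GraphExtension.IsTransferOperator θ μ κ L) ∧
    -- `R(T)` does not depend on the vertex
    (∀ o o' : V, GraphExtension.returnRate θ μ κ o = GraphExtension.returnRate θ μ κ o') ∧
    ∀ L : GraphExtension.HInfty V μ →L[ℂ] GraphExtension.HInfty V μ,
      GraphExtension.IsTransferOperator θ μ κ L →
      (∀ o : V, GraphExtension.returnRate θ μ κ o ≤ spectralRadius ℂ L) ∧
      spectralRadius ℂ L ≤ 1 ∧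
      (GraphExtension.IsSymmetricExtension θ μ κ →
        ∀ o : V, spectralRadius ℂ L = GraphExtension.returnRate θ μ κ o) := by
  have hM := hθ.toIsMarkovMap
  obtain ⟨K, -, hK', hJ⟩ := hθ.exists_branchJacobian_bounds
  have hK := GraphExtension.quasiIndependent_of_branchJacobian_bounds hθ hκ hJ
  refine ⟨?_, fun o o' => ?_, fun L hL => ⟨fun o => ?_, ?_, fun hsymm o => ?_⟩⟩
  · obtain ⟨L, hL⟩ := GraphExtension.exists_isTransferOperator hθ hκ
    exact ⟨L, hL, fun L' hL' => hL'.unique hL hM hκ⟩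
  · exact le_antisymm (GraphExtension.returnRate_le_returnRate hK hK' hθ hκ hT o' o)
      (GraphExtension.returnRate_le_returnRate hK hK' hθ hκ hT o o')
  · exact hL.returnRate_le_spectralRadius hM hκ o
  · exact hL.spectralRadius_le_one hK hK' hM hκ
  · exact le_antisymm (hL.spectralRadius_le_returnRate hK hK' hθ hκ hT hsymm o)
      (hL.returnRate_le_spectralRadius hM hκ o)
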